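/- Let $R$ be a commutative ring in which $2$ is invertible and let $I$ be an ideal of $R$. Let $(Q,q)$ be a quadratic $R$-module, i.e. a finitely generated projective $R$-module with a quadratic form $q$, whose associated bilinear form $\langle x,y\rangle=q(x+y)-q(x)-q(y)$ is non-degenerate. Let $P$ be a finitely generated projective $R$-module of constant rank $m\ge 2$, and let $\mathbb H(P)=P\oplus P^*$ be the hyperbolic space with quadratic form $(x,f)\mapsto f(x)$; suppose that the hyperbolic rank of $\mathbb H(P)$ is at least $2$, i.e. $\mathbb H(P)$ contains two mutually orthogonal hyperbolic pairs $(e_i,f_i)$ (with $e_i,f_i$ isotropic and $\langle e_i,f_i\rangle=1$). Put $M=Q\perp\mathbb H(P)$, and write $q$ and $\langle\ ,\ \rangle$ also for the quadratic form and bilinear form of $M$. Let $n\ge 1$ and suppose that for every maximal ideal $\mathfrak m$ of $R$ the $R_{\mathfrak m}$-module $M_{\mathfrak m}$ has a basis in which the Gram matrix of the localized bilinear form is the standard matrix $\tilde\phi_{n+2m}$; here $\tilde\phi_{2r}$ is the orthogonal sum of $r$ blocks $\begin{pmatrix}0&1\\1&0\end{pmatrix}$ and $\tilde\phi_{2r+1}=(2)\perp\tilde\phi_{2r}$.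 (Then $Q$ has constant rank $n$, and $d:Q\to Q^*$, $z\mapsto\langle z,\cdot\rangle$, is an isomorphism.) For $u,v\in M$ with $u$ unimodular (some linear functional on $M$ takes the value $1$ at $u$), $q(u)=0$ and $\langle u,v\rangle=0$, let $$\sigma_{u,v}(x)=x+u\langle v,x\rangle-v\langle u,x\rangle-u\,q(v)\langle u,x\rangle .$$ Let $\mathrm{TransO}(M)$ be the group generated by all such $\sigma_{u,v}$, and let $\mathrm{TransO}(M,IM)$ be the normal closure in $\mathrm{TransO}(M)$ of the $\sigma_{u,v}$ with $v\in IM$. For linear maps $\alpha:Q\to P$ and $\beta:Q\to P^*$ let $\alpha^*=d^{-1}\circ\alpha^t:P^*\to Q$, and let $\beta^*:P\to Q$ be the composite of the natural map $P\to P^{**}$, $\beta^t$ and $d^{-1}$. For $(z,x,f)\in Q\oplus P\oplus P^*$ put $$E_\alpha(z,x,f)=\bigl(z-\alpha^*(f),\,x+\alpha(z)-\tfrac12\alpha\alpha^*(f),\,f\bigr),\qquad E^*_\beta(z,x,f)=\bigl(z-\beta^*(x),\,x,\,f+\beta(z)-\tfrac12\beta\beta^*(x)\bigr).$$ Let $\mathrm{EO}_R(Q,\mathbb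 H(P))$ be the group generated by all $E_\alpha$ and $E^*_\beta$, and let $\mathrm{EO}_{(R,I)}(Q,\mathbb H(P))$ be the normal closure in it of the subgroup generated by the $E_\alpha$ with $\alpha(Q)\subseteq IP$ and the $E^*_\beta$ with $\beta(Q)\subseteq IP^*$. Then $$\mathrm{TransO}(M,IM)=\mathrm{EO}_{(R,I)}(Q,\mathbb H(P)).$$ -/

import Mathlib

open scoped TensorProduct

namespace DSER

section General

variable {R : Type*} [CommRing R] {M : Type*} [AddCommGroup M] [Module R M]

/-- The symmetric bilinear form `⟨x, y⟩ = q (x + y) - q x - q y` associated with `q`, so that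
`⟨x, x⟩ = 2 q x`. -/
abbrev form (q : QuadraticForm R M) : LinearMap.BilinForm R M := q.polarBilin

/-- `u` is unimodular: some linear functional takes the value `1` at `u`. -/
def IsUnimodular (R : Type*) [CommRing R] {M : Type*} [AddCommGroup M] [Module R M] (u : M) :
    Prop :=
  ∃ φ : Module.Dual R M, φ u = 1

/-- The Eichler-Siegel-Dickson map
`σ_{u,v} x = x + u⟨v,x⟩ - v⟨u,x⟩ - u q(v)⟨u,x⟩`. -/
def esd (q : QuadraticForm R M) (u v x : M) : M :=
  x + form q v x • u - form q u x • v - (q v * form q u x) • u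

/-- The automorphisms of `M` that are ESD transvections `σ_{u,v}` with `u` isotropic and
unimodular, `v` orthogonal to `u`, and `v` in the submodule `N`. -/
def esdTransvections (q : QuadraticForm R M) (N : Submodule R M) : Set (M ≃ₗ[R] M) :=
  {g | ∃ u v : M, IsUnimodular R u ∧ q u = 0 ∧ form q u v = 0 ∧ v ∈ N ∧ ∀ x, g x = esd q u v x}

/-- The ESD transvection group `TransO(M)`. -/
def TransO (q : QuadraticForm R M) : Subgroup (M ≃ₗ[R] M) :=
  Subgroup.closure (esdTransvections q ⊤)

/-- The relative ESD transvection group `TransO(M, IM)`: the normal closure in `TransO(M)` of the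
ESD transvections `σ_{u,v}` with `v ∈ IM`. -/
def TransORel (q : QuadraticForm R M) (I : Ideal R) : Subgroup (M ≃ₗ[R] M) :=
  (Subgroup.normalClosure
    {g : TransO q | (g : M ≃ₗ[R] M) ∈ esdTransvections q (I • ⊤)}).map (TransO q).subtype

/-- The hyperbolic rank of `(M, q)` is at least `k`: there are `k` pairwise orthogonal hyperbolic
pairs `(e i, f i)` in `M`. -/
def HyperbolicRankGE (q : QuadraticForm R M) (k : ℕ) : Prop :=
  ∃ e f : Fin k → M, (∀ i, q (e i) = 0) ∧ (∀ i, q (f i) = 0) ∧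
    (∀ i j, form q (e i) (f j) = if i = j then 1 else 0) ∧
    (∀ i j, i ≠ j → form q (e i) (e j) = 0) ∧ (∀ i j, i ≠ j → form q (f i) (f j) = 0)

end General

/-- The standard symmetric matrix: the orthogonal sum of blocks `(0 1; 1 0)` if `N` is even,
and the orthogonal sum of the `1 × 1` block `2` and such blocks if `N` is odd. -/
def stdMatrix (R : Type*) [CommRing R] (N : ℕ) : Matrix (Fin N) (Fin N) R := fun i j =>
  if Even N then
    if (i : ℕ) / 2 = (j : ℕ) / 2 ∧ i ≠ j then 1 else 0
  else if (i : ℕ) = 0 ∧ (j : ℕ) = 0 then 2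
  else if ((i : ℕ) + 1) / 2 = ((j : ℕ) + 1) / 2 ∧ i ≠ j then 1 else 0

/-- Over `R_𝔪`, the localized module `M_𝔪 = R_𝔪 ⊗ M` has a basis in which the Gram matrix of the
localized bilinear form is the standard symmetric matrix of size `N`. -/
def IsStandardAt {R : Type*} [CommRing R] {M : Type*} [AddCommGroup M] [Module R M]
    (q : QuadraticForm R M) (𝔪 : Ideal R) [𝔪.IsPrime] (N : ℕ) : Prop :=
  ∃ b : Module.Basis (Fin N) (Localization.AtPrime 𝔪) (Localization.AtPrime 𝔪 ⊗[R] M),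
    ∀ i j, LinearMap.BilinForm.baseChange (Localization.AtPrime 𝔪) (form q) (b i) (b j) =
      stdMatrix (Localization.AtPrime 𝔪) N i j

section Hyperbolic

variable {R : Type*} [CommRing R] {Q P : Type*}
  [AddCommGroup Q] [Module R Q] [AddCommGroup P] [Module R P]

/-- The hyperbolic space `H(P) = P ⊕ P*` with `(x, f) ↦ f x`, whose associated bilinear form is
`⟨(x₁, f₁), (x₂, f₂)⟩ = f₂ x₁ + f₁ x₂`. -/
def hyperbolic (R : Type*) [CommRing R] (P : Type*) [AddCommGroup P] [Module R P] :
    QuadraticForm R (P × Module.Dual R P) :=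
  (QuadraticForm.dualProd R P).comp
    (LinearEquiv.prodComm R P (Module.Dual R P) : P × Module.Dual R P →ₗ[R] Module.Dual R P × P)

/-- The quadratic form of the orthogonal sum `Q ⊥ H(P)`. -/
def sumForm (q : QuadraticForm R Q) (P : Type*) [AddCommGroup P] [Module R P] :
    QuadraticForm R (Q × (P × Module.Dual R P)) :=
  QuadraticMap.prod q (hyperbolic R P)

/-- `α' = α* : P* → Q`, that is, `α' = d⁻¹ ∘ αᵗ`, where `d : Q → Q*` is `z ↦ ⟨z, ·⟩` (an
isomorphism when `(Q, q)` is a quadratic space) and `αᵗ : P* → Q*` is the transpose of `α`. -/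
def IsStar (q : QuadraticForm R Q) (α : Q →ₗ[R] P) (α' : Module.Dual R P →ₗ[R] Q) : Prop :=
  form q ∘ₗ α' = α.dualMap

/-- `β' = β* : P → Q`, that is, `β' = d⁻¹ ∘ βᵗ ∘ i`, where `i : P → P**` is the natural map. -/
def IsStarDual (q : QuadraticForm R Q) (β : Q →ₗ[R] Module.Dual R P) (β' : P →ₗ[R] Q) : Prop :=
  form q ∘ₗ β' = β.dualMap ∘ₗ Module.Dual.eval R P

variable [Invertible (2 : R)]

/-- The automorphisms `E_α : (z, x, f) ↦ (z - α* f, x + α z - ½ α α* f, f)` of `Q ⊥ H(P)`, for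
linear `α : Q → P` with values in `IP`. -/
def dserPlus (q : QuadraticForm R Q) (P : Type*) [AddCommGroup P] [Module R P] (I : Ideal R) :
    Set ((Q × (P × Module.Dual R P)) ≃ₗ[R] (Q × (P × Module.Dual R P))) :=
  {g | ∃ (α : Q →ₗ[R] P) (α' : Module.Dual R P →ₗ[R] Q), IsStar q α α' ∧
    (∀ z, α z ∈ I • (⊤ : Submodule R P)) ∧
    ∀ z x f, g (z, (x, f)) = (z - α' f, (x + α z - (⅟2 : R) • α (α' f), f))}

/-- The automorphisms `E*_β : (z, x, f) ↦ (z - β* x, x, f + β z - ½ β β* x)` of `Q ⊥ H(P)`, for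
linear `β : Q → P*` with values in `IP*`. -/
def dserMinus (q : QuadraticForm R Q) (P : Type*) [AddCommGroup P] [Module R P] (I : Ideal R) :
    Set ((Q × (P × Module.Dual R P)) ≃ₗ[R] (Q × (P × Module.Dual R P))) :=
  {g | ∃ (β : Q →ₗ[R] Module.Dual R P) (β' : P →ₗ[R] Q), IsStarDual q β β' ∧
    (∀ z, β z ∈ I • (⊤ : Submodule R (Module.Dual R P))) ∧
    ∀ z x f, g (z, (x, f)) = (z - β' x, (x, f + β z - (⅟2 : R) • β (β' x)))}

/-- The true relative DSER elementary orthogonal group `EO_I(Q, H(P))`. -/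
def EOTrue (q : QuadraticForm R Q) (P : Type*) [AddCommGroup P] [Module R P] (I : Ideal R) :
    Subgroup ((Q × (P × Module.Dual R P)) ≃ₗ[R] (Q × (P × Module.Dual R P))) :=
  Subgroup.closure (dserPlus q P I ∪ dserMinus q P I)

/-- The DSER elementary orthogonal group `EO_R(Q, H(P))`. -/
def EO (q : QuadraticForm R Q) (P : Type*) [AddCommGroup P] [Module R P] :
    Subgroup ((Q × (P × Module.Dual R P)) ≃ₗ[R] (Q × (P × Module.Dual R P))) :=
  EOTrue q P ⊤

/-- The relative DSER elementary orthogonal group `EO_{(R,I)}(Q, H(P))`: the normal closure of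
`EO_I(Q, H(P))` in `EO_R(Q, H(P))`. -/
def EORel (q : QuadraticForm R Q) (P : Type*) [AddCommGroup P] [Module R P] (I : Ideal R) :
    Subgroup ((Q × (P × Module.Dual R P)) ≃ₗ[R] (Q × (P × Module.Dual R P))) :=
  (Subgroup.normalClosure
    (((EOTrue q P I).subgroupOf (EO q P) : Subgroup (EO q P)) : Set (EO q P))).map
      (EO q P).subtype

end Hyperbolic

end DSER

/-!
The proof is direct and uses neither localization of groups nor patching. For subgroups `H` and `N`
of `GL(M)`, with `N` normalized by `H`, and an isotropic vector `u`, let `D(u)` be the set of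
`v ∈ u^⊥` for which every `σ_{u,av}` lies in `H`, and in `N` when `a ∈ I`
(`transvectionModule`). Since `σ_{u,v} σ_{u,w} = σ_{u,v+w}`, this is a submodule. Moreover
`v ∈ D(u)` is symmetric in isotropic `u` and `v`, and `D(gu) = g D(u)` for the transvections `g`
in `H`.

The central result is `EichlerFrame.bracket_mem`. Let `M = A + B + C` with `A` and `B` totally
isotropic and `C` orthogonal to both, let `C ≤ D(x)` for all `x ∈ A ∪ B`, and let the pairings on
`C` and between `A` and `B` have enough values. Then `[y, z]_u = ⟨u,y⟩z - ⟨u,z⟩y` is in `D(u)` for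
*all* isotropic `u` and all `y` and `z`. Commutators of the given transvections yield
`D(x) = x^⊥` for `x ∈ A ∪ B`; hence `[x, x']_u`, which for `x, x' ∈ A` is an element of `A`
orthogonal to `u`, is in `D(u)`. The set of pairs `(y, z)` with `[y, z]_u ∈ D(u)` for all isotropic
`u` is stable under the transvections in `H`, and conjugating by `σ_{f,w}` with `f ∈ B` and `w ∈ C`
reaches all other pairs.

With `A = P`, `B = P*` and `C = Q` this applies to `EO`: if `u` is unimodular, say `⟨u,y⟩ = 1`, and
`v = ∑ aᵢ vᵢ` is orthogonal to `u` with `aᵢ ∈ I`, then `v = ∑ aᵢ [y, vᵢ]_u`, so that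
`σ_{u,v}` lies in the relative group `EO` (`esdTransvections_subset_EORel`).

Conversely, two orthogonal hyperbolic pairs in `H(P)` and their complement form such a frame for
`TransO`. Now `⟨x,y⟩w ∈ D(x)` for all `x ∈ P`, all `w ∈ P + Q` and all `y`, and writing `x` as
`(x + x') - x'` removes the factor although `x` need not be unimodular
(`EichlerFrame.mem_of_totally_isotropic`). Finally `E_α` is the exponential of the skew-symmetric
endomorphism `(z, x, f) ↦ (-α* f, α z, 0)`, a sum of endomorphisms `a(⟨w,·⟩x - ⟨x,·⟩w)` with
`a ∈ I`, and the exponential of such a sum is a product of transvections `σ_{x,w}` and `σ_{x,x'}`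
(`exists_exp_of_mem_skewMonoid`).

The local hypotheses enter only through three facts: `M → M*` is surjective, the values of the form
on `Q` generate the unit ideal because `n ≥ 1`, and, as `P` has rank at least `2`, the elements
`f(x)x' - f(x')x` generate `P`.
-/

namespace DSER

/-! ### Transvections and the modules they define -/

section Calculus

variable {R : Type*} [CommRing R] {M : Type*} [AddCommGroup M] [Module R M]
  (q : QuadraticForm R M)

lemma form_comm (x y : M) : form q x y = form q y x := by
  simp [form, QuadraticMap.polar_comm]

lemma form_self (x : M) : form q x x = 2 * q x := by
  simp [form, QuadraticMap.polar_self]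

lemma q_add (x y : M) : q (x + y) = q x + q y + form q x y := by
  simp [form, QuadraticMap.polar]

lemma q_smul (a : R) (x : M) : q (a • x) = a * a * q x := by
  rw [QuadraticMap.map_smul, smul_eq_mul]

lemma form_self_of_isotropic {x : M} (hx : q x = 0) : form q x x = 0 := by
  rw [form_self, hx, mul_zero]

variable {q}

lemma esd_comp {u v w : M} (hu : q u = 0) (hv : form q u v = 0) (hw : form q u w = 0) (y : M) :
    esd q u v (esd q u w y) = esd q u (v + w) y := by
  have huu := form_self_of_isotropic q hu
  have hv' := (form_comm q v u).trans hv
  simp only [esd, map_add, map_sub, map_smul, LinearMap.add_apply, smul_eq_mul, huu, hv', hw, q_add]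
  module

lemma esd_zero (u y : M) : esd q u 0 y = y := by
  simp [esd]

/-- The ESD transvection `σ_{u,v}` as a linear automorphism, for `u` isotropic and orthogonal
to `v`; its inverse is `σ_{u,-v}`. -/
def esdEquiv (q : QuadraticForm R M) {u v : M} (hu : q u = 0) (hv : form q u v = 0) :
    M ≃ₗ[R] M where
  toFun := esd q u v
  map_add' x y := by
    simp only [esd, map_add]
    module
  map_smul' a x := by
    simp only [esd, map_smul, smul_eq_mul, RingHom.id_apply]
    module
  invFun := esd q u (-v)
  left_inv y := by
    rw [esd_comp hu (by simp only [map_neg, hv, neg_zero]) hv, neg_add_cancel, esd_zero]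
  right_inv y := by
    rw [esd_comp hu hv (by simp only [map_neg, hv, neg_zero]), add_neg_cancel, esd_zero]

lemma form_esd {u v : M} (hu : q u = 0) (hv : form q u v = 0) (x y : M) :
    form q (esd q u v x) (esd q u v y) = form q x y := by
  have huu := form_self_of_isotropic q hu
  have hv' := (form_comm q v u).trans hv
  simp only [esd, map_add, map_sub, map_smul, LinearMap.add_apply, LinearMap.sub_apply,
    LinearMap.smul_apply, smul_eq_mul, huu, hv', hv, form_self, form_comm q x u,
    form_comm q x v]
  ring

lemma q_esd {u v : M} (hu : q u = 0) (hv : form q u v = 0) (x : M) :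
    q (esd q u v x) = q x := by
  have huu := form_self_of_isotropic q hu
  have hv' := (form_comm q v u).trans hv
  have h1 : esd q u v x = x + ((form q v x - q v * form q u x) • u + (-form q u x) • v) := by
    simp only [esd]; module
  rw [h1]
  simp only [q_add, q_smul, map_add, map_smul,
    LinearMap.smul_apply, smul_eq_mul, hv, hu, form_comm q x u, form_comm q x v]
  ring

/-- `σ_{u,v} = σ_{v,-u}` for orthogonal isotropic `u` and `v`. -/
lemma esd_swap {u v : M} (hu : q u = 0) (hv : q v = 0) (y : M) :
    esd q v u y = esd q u (-v) y := by
  simp only [esd, map_neg, LinearMap.neg_apply, hu, QuadraticMap.map_neg, hv]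
  module

lemma esd_smul_left (t : R) (u v y : M) : esd q (t • u) v y = esd q u (t • v) y := by
  simp only [esd, map_smul, LinearMap.smul_apply, smul_eq_mul, q_smul]
  module

/-- Conjugation by an isometry `g` turns `σ_{u,v}` into `σ_{gu,gv}`. -/
lemma conj_esd {g h : M ≃ₗ[R] M} (hg : ∀ x y, form q (g x) (g y) = form q x y)
    (hgq : ∀ x, q (g x) = q x) {u v : M} (hh : ∀ y, h y = esd q u v y) (y : M) :
    (g * h * g⁻¹) y = esd q (g u) (g v) y := by
  have key : ∀ x, g (h x) = esd q (g u) (g v) (g x) := fun x => by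
    rw [hh]
    simp only [esd, map_add, map_sub, map_smul, hg, hgq]
  have : g (g⁻¹ y) = y := by
    rw [← LinearEquiv.mul_apply, mul_inv_cancel]; rfl
  calc (g * h * g⁻¹) y = g (h (g⁻¹ y)) := rfl
    _ = _ := by rw [key, this]

end Calculus

section TransvectionModule

variable {R : Type*} [CommRing R] {M : Type*} [AddCommGroup M] [Module R M]

/-- For subgroups `H` and `N` of `GL(M)` and an ideal `I`: the vectors `v` orthogonal to the
isotropic vector `u` such that all `σ_{u,av}` lie in `H`, and even in `N` when `a ∈ I`. For `u`
not isotropic this is all of `M`, a value that is never used. -/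
def transvectionModule (q : QuadraticForm R M) (I : Ideal R) (H N : Subgroup (M ≃ₗ[R] M)) (u : M) :
    Submodule R M where
  carrier := {v | q u = 0 → form q u v = 0 ∧
    ∀ a : R, ∃ g : M ≃ₗ[R] M, (∀ y, g y = esd q u (a • v) y) ∧ g ∈ H ∧ (a ∈ I → g ∈ N)}
  zero_mem' _ := ⟨map_zero _, fun a => ⟨1, fun y => by rw [smul_zero, esd_zero]; rfl,
    H.one_mem, fun _ => N.one_mem⟩⟩
  add_mem' := by
    intro v w hv hw hu
    obtain ⟨hv0, hv⟩ := hv hu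
    obtain ⟨hw0, hw⟩ := hw hu
    refine ⟨by rw [map_add, hv0, hw0, add_zero], fun a => ?_⟩
    obtain ⟨g, hg, hgH, hgN⟩ := hv a
    obtain ⟨h, hh, hhH, hhN⟩ := hw a
    refine ⟨g * h, fun y => ?_, H.mul_mem hgH hhH, fun ha => N.mul_mem (hgN ha) (hhN ha)⟩
    rw [LinearEquiv.mul_apply, hh, hg, esd_comp hu (by rw [map_smul, hv0, smul_zero])
      (by rw [map_smul, hw0, smul_zero]), smul_add]
  smul_mem' := by
    intro c v hv hu
    obtain ⟨hv0, hv⟩ := hv hu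
    refine ⟨by rw [map_smul, hv0, smul_zero], fun a => ?_⟩
    obtain ⟨g, hg, hgH, hgN⟩ := hv (a * c)
    exact ⟨g, fun y => by rw [hg, mul_smul], hgH, fun ha => hgN (I.mul_mem_right _ ha)⟩

variable {q : QuadraticForm R M} {I : Ideal R} {H N : Subgroup (M ≃ₗ[R] M)}

local notation "𝓓" => transvectionModule q I H N

lemma mem_transvectionModule {u v : M} (hu : q u = 0) :
    v ∈ 𝓓 u ↔ form q u v = 0 ∧ ∀ a : R, ∃ g : M ≃ₗ[R] M,
      (∀ y, g y = esd q u (a • v) y) ∧ g ∈ H ∧ (a ∈ I → g ∈ N) :=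
  ⟨fun h => h hu, fun h _ => h⟩

lemma form_eq_zero_of_mem {u v : M} (hu : q u = 0) (h : v ∈ 𝓓 u) : form q u v = 0 :=
  ((mem_transvectionModule hu).1 h).1

lemma mem_transvectionModule_symm {u v : M} (hu : q u = 0) (hv : q v = 0) (h : v ∈ 𝓓 u) :
    u ∈ 𝓓 v := by
  obtain ⟨h0, h⟩ := (mem_transvectionModule hu).1 h
  refine (mem_transvectionModule hv).2 ⟨(form_comm q v u).trans h0, fun a => ?_⟩
  obtain ⟨g, hg, hgH, hgN⟩ := h (-a)
  refine ⟨g, fun y => ?_, hgH, fun ha => hgN (I.neg_mem ha)⟩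
  rw [hg, esd_swap (u := a • u) (by rw [q_smul, hu, mul_zero]) hv, esd_smul_left, smul_neg,
    neg_smul]

lemma mem_transvectionModule_smul_left {u v : M} (hu : q u = 0) (t : R) (h : v ∈ 𝓓 u) :
    v ∈ 𝓓 (t • u) := by
  obtain ⟨h0, h⟩ := (mem_transvectionModule hu).1 h
  refine (mem_transvectionModule (by rw [q_smul, hu, mul_zero])).2
    ⟨by rw [map_smul, LinearMap.smul_apply, h0, smul_zero], fun a => ?_⟩
  obtain ⟨g, hg, hgH, hgN⟩ := h (t * a)
  exact ⟨g, fun y => by rw [hg, esd_smul_left, smul_smul], hgH,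
    fun ha => hgN (I.mul_mem_left _ ha)⟩

/-- The transvections of `H` act on the modules `transvectionModule q I H N u` by conjugation. -/
lemma esd_mem_transvectionModule (hN : ∀ h ∈ H, ∀ n ∈ N, h * n * h⁻¹ ∈ N) {e w u v : M}
    (he : q e = 0) (hw : w ∈ 𝓓 e) (hu : q u = 0) (hv : v ∈ 𝓓 u) :
    esd q e w v ∈ 𝓓 (esd q e w u) := by
  obtain ⟨hw0, hw⟩ := (mem_transvectionModule he).1 hw
  obtain ⟨hv0, hv⟩ := (mem_transvectionModule hu).1 hv
  obtain ⟨g, hg, hgH, -⟩ := hw 1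
  simp only [one_smul] at hg
  have hgf : ∀ x y, form q (g x) (g y) = form q x y := fun x y => by
    rw [hg, hg, form_esd he hw0]
  have hgq : ∀ x, q (g x) = q x := fun x => by rw [hg, q_esd he hw0]
  rw [← hg, ← hg]
  refine (mem_transvectionModule (by rw [hgq, hu])).2 ⟨by rw [hgf, hv0], fun a => ?_⟩
  obtain ⟨h, hh, hhH, hhN⟩ := hv a
  refine ⟨g * h * g⁻¹, fun y => ?_, H.mul_mem (H.mul_mem hgH hhH) (H.inv_mem hgH),
    fun ha => hN g hgH h (hhN ha)⟩
  rw [conj_esd hgf hgq hh, map_smul]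

/-- If `x` and `y` are orthogonal, then `σ_{x+y,w}` is the product of `σ_{x,w}`, `σ_{y,w}` and
`σ_{x,q(w)y}`. -/
lemma mem_transvectionModule_add_left {x y w : M} (hx : q x = 0) (hy : q y = 0)
    (hxw : w ∈ 𝓓 x) (hyw : w ∈ 𝓓 y) (hxy : form q x y = 0) (h : q w • y ∈ 𝓓 x) :
    w ∈ 𝓓 (x + y) := by
  obtain ⟨hxw0, hxw⟩ := (mem_transvectionModule hx).1 hxw
  obtain ⟨hyw0, hyw⟩ := (mem_transvectionModule hy).1 hyw
  obtain ⟨-, h⟩ := (mem_transvectionModule hx).1 h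
  have hq : q (x + y) = 0 := by rw [q_add, hx, hy, hxy]; simp
  refine (mem_transvectionModule hq).2
    ⟨by rw [map_add, LinearMap.add_apply, hxw0, hyw0, add_zero], fun a => ?_⟩
  obtain ⟨g₁, hg₁, hg₁H, hg₁N⟩ := hxw a
  obtain ⟨g₂, hg₂, hg₂H, hg₂N⟩ := hyw a
  obtain ⟨g₃, hg₃, hg₃H, hg₃N⟩ := h (a * a)
  refine ⟨g₁ * g₂ * g₃, fun z => ?_, H.mul_mem (H.mul_mem hg₁H hg₂H) hg₃H,
    fun ha => N.mul_mem (N.mul_mem (hg₁N ha) (hg₂N ha)) (hg₃N (I.mul_mem_left _ ha))⟩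
  have hxx := form_self_of_isotropic q hx
  have hyy := form_self_of_isotropic q hy
  have hyx := (form_comm q y x).trans hxy
  have hwx := (form_comm q w x).trans hxw0
  have hwy := (form_comm q w y).trans hyw0
  rw [LinearEquiv.mul_apply, LinearEquiv.mul_apply, hg₃, hg₂, hg₁]
  simp only [esd, map_add, map_sub, map_smul, LinearMap.add_apply,
    LinearMap.smul_apply, smul_eq_mul, q_smul, hxx, hyy, hxy, hyx, hwx, hwy, hxw0,
    form_self, hy]
  module

end TransvectionModule

/-! ### Frames and brackets -/

section Generation

variable {R : Type*} [CommRing R] {M : Type*} [AddCommGroup M] [Module R M]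

lemma mem_of_span_eq_top {D : Submodule R M} {S : Set R} (hS : Ideal.span S = ⊤) {v : M}
    (h : ∀ s ∈ S, s • v ∈ D) : v ∈ D := by
  have h1 : Ideal.span S ≤ D.comap (LinearMap.toSpanSingleton R M v) :=
    Ideal.span_le.2 fun s hs => by simpa using h s hs
  have h2 : (1 : R) ∈ D.comap (LinearMap.toSpanSingleton R M v) := h1 (hS ▸ Submodule.mem_top)
  simpa using h2

/-- The alternating operation `[y, z]_u = ⟨u,y⟩z - ⟨u,z⟩y`, with values orthogonal to `u`. -/
def bracket (q : QuadraticForm R M) (u y z : M) : M := form q u y • z - form q u z • y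

variable {q : QuadraticForm R M}

lemma bracket_swap (u y z : M) : bracket q u y z = -bracket q u z y := by
  simp only [bracket]; module

lemma bracket_self (u y : M) : bracket q u y y = 0 := sub_self _

lemma form_bracket (u y z : M) : form q u (bracket q u y z) = 0 := by
  simp only [bracket, map_sub, map_smul, smul_eq_mul]; ring

/-- `bracket` as a linear map in its last argument. -/
def bracketₗ (q : QuadraticForm R M) (u y : M) : M →ₗ[R] M :=
  form q u y • LinearMap.id - (form q u).smulRight y

@[simp] lemma bracketₗ_apply (u y z : M) : bracketₗ q u y z = bracket q u y z := rfl

variable {I : Ideal R} {H N : Subgroup (M ≃ₗ[R] M)}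


lemma mem_of_two_smul_mem [Invertible (2 : R)] {D : Submodule R M} {v : M}
    (h : (2 : R) • v ∈ D) : v ∈ D := by
  have := D.smul_mem (⅟2 : R) h
  rwa [smul_smul, invOf_mul_self, one_smul] at this

local notation "𝓓" => transvectionModule q I H N

/-- Two totally isotropic submodules `A` and `B` and a submodule `C` orthogonal to both which
together span `M`, such that all `σ_{x,w}` with `x ∈ A ∪ B` and `w ∈ C` belong to the groups in
question, and such that the pairings of `C` with `C` and of `A` with `B` have enough values. -/
structure EichlerFrame (q : QuadraticForm R M) (I : Ideal R) (H N : Subgroup (M ≃ₗ[R] M))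
    (A B C : Submodule R M) : Prop where
  conj_mem : ∀ h ∈ H, ∀ n ∈ N, h * n * h⁻¹ ∈ N
  isotropic_left : ∀ x ∈ A, q x = 0
  isotropic_right : ∀ f ∈ B, q f = 0
  form_left : ∀ x ∈ A, ∀ w ∈ C, form q x w = 0
  form_right : ∀ f ∈ B, ∀ w ∈ C, form q f w = 0
  le_left : ∀ x ∈ A, C ≤ transvectionModule q I H N x
  le_right : ∀ f ∈ B, C ≤ transvectionModule q I H N f
  sup_eq_top : A ⊔ B ⊔ C = ⊤
  span_form : Ideal.span {r | ∃ w ∈ C, ∃ w' ∈ C, r = form q w w'} = ⊤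
  span_pairing : Ideal.span {r | ∃ x ∈ A, ∃ f ∈ B, r = form q f x} = ⊤
  span_left : A ≤ Submodule.span R {p | ∃ x ∈ A, ∃ x' ∈ A, ∃ f ∈ B, p = bracket q f x x'}
  span_right : B ≤ Submodule.span R {p | ∃ f ∈ B, ∃ f' ∈ B, ∃ x ∈ A, p = bracket q x f f'}

namespace EichlerFrame

variable {A B C : Submodule R M}

lemma symm (F : EichlerFrame q I H N A B C) : EichlerFrame q I H N B A C where
  conj_mem := F.conj_mem
  isotropic_left := F.isotropic_right
  isotropic_right := F.isotropic_left
  form_left := F.form_right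
  form_right := F.form_left
  le_left := F.le_right
  le_right := F.le_left
  sup_eq_top := by rw [sup_comm B A, F.sup_eq_top]
  span_form := F.span_form
  span_pairing := by
    rw [← F.span_pairing]
    congr 1
    ext r
    constructor
    · rintro ⟨f, hf, x, hx, rfl⟩
      exact ⟨x, hx, f, hf, form_comm q _ _⟩
    · rintro ⟨x, hx, f, hf, rfl⟩
      exact ⟨f, hf, x, hx, form_comm q _ _⟩
  span_left := F.span_right
  span_right := F.span_left

lemma form_self_left (F : EichlerFrame q I H N A B C) {x y : M} (hx : x ∈ A) (hy : y ∈ A) :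
    form q x y = 0 := by
  have h := q_add q x y
  rw [F.isotropic_left _ (A.add_mem hx hy), F.isotropic_left _ hx, F.isotropic_left _ hy] at h
  simpa using h.symm

/-- The conjugate of `σ_{h,w}` by `σ_{k,w'}` is `σ_{h,w+⟨w',w⟩k}`. -/
lemma mem_of_orthogonal (F : EichlerFrame q I H N A B C) {h k : M} (hh : q h = 0) (hk : q k = 0)
    (hhk : form q h k = 0) (hC : C ≤ 𝓓 h) (kC : C ≤ 𝓓 k) : k ∈ 𝓓 h := by
  refine mem_of_span_eq_top F.span_form ?_
  rintro _ ⟨w', hw', w, hw, rfl⟩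
  have key := esd_mem_transvectionModule F.conj_mem hk (kC hw') hh (hC hw)
  have h1 : esd q k w' h = h := by
    simp only [esd, form_comm q w' h, form_eq_zero_of_mem hh (hC hw'), form_comm q k h, hhk]
    simp
  have h2 : esd q k w' w = w + form q w' w • k := by
    simp only [esd, form_eq_zero_of_mem hk (kC hw)]
    simp
  rw [h1, h2] at key
  simpa using Submodule.sub_mem _ key (hC hw)

lemma mem_of_mem_left (F : EichlerFrame q I H N A B C) {x v : M} (hx : x ∈ A)
    (hv : form q x v = 0) : v ∈ 𝓓 x := by
  have hxq := F.isotropic_left x hx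
  have hv' : v ∈ A ⊔ B ⊔ C := F.sup_eq_top ▸ Submodule.mem_top
  obtain ⟨s, hs, w, hw, rfl⟩ := Submodule.mem_sup.1 hv'
  obtain ⟨y, hy, f, hf, rfl⟩ := Submodule.mem_sup.1 hs
  simp only [map_add, F.form_self_left hx hy, F.form_left x hx w hw, zero_add, add_zero] at hv
  exact add_mem (add_mem
    (F.mem_of_orthogonal hxq (F.isotropic_left y hy) (F.form_self_left hx hy) (F.le_left x hx)
      (F.le_left y hy))
    (F.mem_of_orthogonal hxq (F.isotropic_right f hf) hv (F.le_left x hx) (F.le_right f hf)))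
    (F.le_left x hx hw)

/-- The bracket of two elements of `A` is an element of `A` orthogonal to `u`. -/
lemma bracket_left_left (F : EichlerFrame q I H N A B C) {x y u : M} (hx : x ∈ A) (hy : y ∈ A)
    (hu : q u = 0) : bracket q u x y ∈ 𝓓 u := by
  have hp : bracket q u x y ∈ A := sub_mem (A.smul_mem _ hy) (A.smul_mem _ hx)
  refine mem_transvectionModule_symm (F.isotropic_left _ hp) hu (F.mem_of_mem_left hp ?_)
  rw [form_comm, form_bracket]

/-- If `[y, z]_u ∈ D(u)` for all isotropic `u`, then also `[gy, gz]_u ∈ D(u)` for every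
transvection `g` of the frame. -/
lemma bracket_esd (F : EichlerFrame q I H N A B C) {e w y z : M} (he : q e = 0) (hw : w ∈ 𝓓 e)
    (h : ∀ u, q u = 0 → bracket q u y z ∈ 𝓓 u) {u : M} (hu : q u = 0) :
    bracket q u (esd q e w y) (esd q e w z) ∈ 𝓓 u := by
  have hw0 := form_eq_zero_of_mem he hw
  have hw1 : form q e (-w) = 0 := by rw [map_neg, hw0, neg_zero]
  have key := esd_mem_transvectionModule F.conj_mem he hw (u := esd q e (-w) u)
    ((q_esd he hw1 u).trans hu) (h _ ((q_esd he hw1 u).trans hu))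
  have hback : esd q e w (esd q e (-w) u) = u := by
    rw [esd_comp he hw0 hw1, add_neg_cancel, esd_zero]
  rw [hback] at key
  convert key using 1
  rw [bracket, bracket, ← form_esd he hw0 _ y, ← form_esd he hw0 _ z, hback]
  change _ = esdEquiv q he hw0 _
  rw [map_sub, map_smul, map_smul]
  rfl

variable [Invertible (2 : R)]

lemma bracket_left_orthogonal (F : EichlerFrame q I H N A B C) {x w u : M} (hx : x ∈ A)
    (hw : w ∈ C) (hu : q u = 0) : bracket q u x w ∈ 𝓓 u := by
  suffices h : A ≤ (𝓓 u).comap (bracketₗ q u w) by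
    rw [bracket_swap]
    exact neg_mem (h hx)
  refine F.span_left.trans (Submodule.span_le.2 ?_)
  rintro _ ⟨y, hy, y', hy', f, hf, rfl⟩
  -- The terms of odd degree in `w` of the bracket of the images of `y` and `y'` under `σ_{f,w}`.
  have hyy : ∀ u, q u = 0 → bracket q u y y' ∈ 𝓓 u := fun u hu => F.bracket_left_left hy hy' hu
  have hf0 := F.isotropic_right f hf
  have h1 := F.bracket_esd hf0 (F.le_right f hf hw) hyy hu
  have h2 := F.bracket_esd hf0 (F.le_right f hf (C.neg_mem hw)) hyy hu
  have hwy := (form_comm q w y).trans (F.form_left y hy w hw)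
  have hwy' := (form_comm q w y').trans (F.form_left y' hy' w hw)
  change bracket q u w (bracket q f y y') ∈ 𝓓 u
  refine mem_of_two_smul_mem ?_
  convert sub_mem h2 h1 using 1
  simp only [bracket, esd, map_add, map_sub, map_smul, map_neg,
    LinearMap.neg_apply, smul_eq_mul, QuadraticMap.map_neg, hwy, hwy']
  module

/-- Conjugating by `σ_{f,w'}` with `f ∈ B` relates the brackets of `A` with `B` to those of
`C` with `C`. -/
lemma bracket_relation (F : EichlerFrame q I H N A B C) {x f w w' u : M} (hx : x ∈ A) (hf : f ∈ B)
    (hw : w ∈ C) (hw' : w' ∈ C) (hu : q u = 0) :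
    form q w' w • bracket q u x f - form q f x • bracket q u w' w ∈ 𝓓 u := by
  have h0 : ∀ u, q u = 0 → bracket q u x w ∈ 𝓓 u :=
    fun u hu => F.bracket_left_orthogonal hx hw hu
  have h1 := F.bracket_esd (F.isotropic_right f hf) (F.le_right f hf hw') h0 hu
  have h2 := F.symm.bracket_left_orthogonal hf hw hu
  have h3 := F.symm.bracket_left_orthogonal hf hw' hu
  have hwx := (form_comm q w' x).trans (F.form_left x hx w' hw')
  have hfw := F.form_right f hf w hw
  convert add_mem (sub_mem (sub_mem h1 (h0 u hu)) (Submodule.smul_mem _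
    (form q f x * form q w' w) h3)) (Submodule.smul_mem _ (q w' * form q f x) h2) using 1
  simp only [bracket, esd, map_add, map_sub, map_smul, smul_eq_mul, hwx, hfw]
  module

lemma bracket_left_right (F : EichlerFrame q I H N A B C) {x f u : M} (hx : x ∈ A) (hf : f ∈ B)
    (hu : q u = 0) : bracket q u x f ∈ 𝓓 u := by
  have hself : ∀ w ∈ C, form q w w • bracket q u x f ∈ 𝓓 u := fun w hw => by
    simpa [bracket_self] using F.bracket_relation hx hf hw hw hu
  refine mem_of_span_eq_top F.span_form ?_
  rintro _ ⟨w, hw, w', hw', rfl⟩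
  refine mem_of_two_smul_mem ?_
  convert sub_mem (sub_mem (hself _ (C.add_mem hw hw')) (hself _ hw)) (hself _ hw') using 1
  simp only [map_add, LinearMap.add_apply, form_comm q w' w]
  module

lemma bracket_orthogonal_orthogonal (F : EichlerFrame q I H N A B C) {w w' u : M} (hw : w ∈ C)
    (hw' : w' ∈ C) (hu : q u = 0) : bracket q u w w' ∈ 𝓓 u := by
  refine mem_of_span_eq_top F.span_pairing ?_
  rintro _ ⟨x, hx, f, hf, rfl⟩
  have h1 := F.bracket_relation hx hf hw' hw hu
  have h2 := Submodule.smul_mem _ (form q w w') (F.bracket_left_right hx hf hu)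
  simpa using sub_mem h2 h1

/-- The brackets formed with an isotropic `u`, which need not be unimodular, lie in `D(u)`. -/
theorem bracket_mem (F : EichlerFrame q I H N A B C) {u : M} (hu : q u = 0) (y z : M) :
    bracket q u y z ∈ 𝓓 u := by
  have key : ∀ {a b : M}, bracket q u a b ∈ 𝓓 u → bracket q u b a ∈ 𝓓 u := fun h => by
    rw [bracket_swap]; exact neg_mem h
  -- By linearity it suffices to let both arguments range over `A`, `B` and `C`.
  have reduce : ∀ a : M, (∀ x ∈ A, bracket q u a x ∈ 𝓓 u) → (∀ f ∈ B, bracket q u a f ∈ 𝓓 u) →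
      (∀ w ∈ C, bracket q u a w ∈ 𝓓 u) → ∀ b, bracket q u a b ∈ 𝓓 u := by
    intro a hA hB hC b
    have h : A ⊔ B ⊔ C ≤ (𝓓 u).comap (bracketₗ q u a) := sup_le (sup_le hA hB) hC
    exact h (F.sup_eq_top ▸ Submodule.mem_top)
  refine reduce y (fun x hx => key ?_) (fun f hf => key ?_) (fun w hw => key ?_) z
  · exact reduce x (fun a ha => F.bracket_left_left hx ha hu)
      (fun f hf => F.bracket_left_right hx hf hu)
      (fun w hw => F.bracket_left_orthogonal hx hw hu) y
  · exact reduce f (fun a ha => key (F.bracket_left_right ha hf hu))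
      (fun g hg => F.symm.bracket_left_left hf hg hu)
      (fun w hw => F.symm.bracket_left_orthogonal hf hw hu) y
  · exact reduce w (fun a ha => key (F.bracket_left_orthogonal ha hw hu))
      (fun g hg => key (F.symm.bracket_left_orthogonal hg hw hu))
      (fun w' hw' => F.bracket_orthogonal_orthogonal hw hw' hu) y

/-- For isotropic `u`, the pairing of `u` with anything takes `u^⊥` into `D(u)`. -/
lemma form_smul_mem (F : EichlerFrame q I H N A B C) {u v : M} (hu : q u = 0)
    (hv : form q u v = 0) (y : M) : form q u y • v ∈ 𝓓 u := by
  simpa [bracket, hv] using F.bracket_mem hu y v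

end EichlerFrame

end Generation

/-! ### Projective modules at maximal ideals and standard forms -/

section LocalAlgebra

variable {R : Type*} [CommRing R]

/-- An ideal with an element outside every maximal ideal is the unit ideal. -/
lemma ideal_eq_top_of_forall_maximal {J : Ideal R}
    (h : ∀ 𝔪 : Ideal R, 𝔪.IsMaximal → ∃ r ∈ J, r ∉ 𝔪) : J = ⊤ := by
  by_contra hJ
  obtain ⟨𝔪, hm, hle⟩ := Ideal.exists_le_maximal J hJ
  obtain ⟨r, hr, hr'⟩ := h 𝔪 hm
  exact hr' (hle hr)

section Projective

variable {P : Type*} [AddCommGroup P] [Module R P] [Module.Finite R P] [Module.Projective R P]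

lemma rankAtStalk_dual (p : PrimeSpectrum R) :
    Module.rankAtStalk (Module.Dual R P) p = Module.rankAtStalk P p := by
  have : Module.FinitePresentation R P := Module.finitePresentation_of_projective R P
  have hfree : Module.Free (Localization.AtPrime p.asIdeal)
      (LocalizedModule p.asIdeal.primeCompl P) := Module.free_of_flat_of_isLocalRing
  have hfree' : Module.Free (Localization.AtPrime p.asIdeal)
      (LocalizedModule p.asIdeal.primeCompl R) := Module.free_of_flat_of_isLocalRing
  have h1 := ((Module.FinitePresentation.linearEquivMapExtendScalars (M := P) (N := R)
    p.asIdeal.primeCompl).extendScalarsOfIsLocalization p.asIdeal.primeCompl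
    (Localization.AtPrime p.asIdeal)).finrank_eq
  have : Nontrivial R := p.nontrivial
  have h2 : Module.rankAtStalk R p = 1 := by rw [Module.rankAtStalk_self]; rfl
  rw [Module.rankAtStalk] at h2 ⊢
  rw [Module.rankAtStalk]
  refine h1.trans ?_
  have h3 := Module.finrank_linearMap (Localization.AtPrime p.asIdeal)
    (Localization.AtPrime p.asIdeal)
    (LocalizedModule p.asIdeal.primeCompl P) (LocalizedModule p.asIdeal.primeCompl R)
  rw [h2, mul_one] at h3
  exact h3

variable (R P) in
/-- The dual basis lemma. -/
lemma exists_dual_basis : ∃ (k : ℕ) (φ : Fin k → Module.Dual R P) (x : Fin k → P),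
    ∀ y, y = ∑ i, φ i y • x i := by
  obtain ⟨k, f, g, -, -, h⟩ := Module.Finite.exists_comp_eq_id_of_projective R P
  refine ⟨k, fun i => LinearMap.proj i ∘ₗ g, fun i => f (Pi.single i 1), fun y => ?_⟩
  have h1 : f (g y) = y := LinearMap.congr_fun h y
  conv_lhs => rw [← h1, pi_eq_sum_univ' (g y), map_sum]
  refine Finset.sum_congr rfl fun i _ => ?_
  rw [map_smul]
  rfl

/-- An element on which all functionals take values in `J` lies in `J • P`. -/
lemma mem_smul_top_of_forall_dual {J : Ideal R} {y : P}
    (h : ∀ φ : Module.Dual R P, φ y ∈ J) : y ∈ J • (⊤ : Submodule R P) := by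
  obtain ⟨k, φ, x, hx⟩ := exists_dual_basis R P
  rw [hx y]
  exact sum_mem fun i _ => Submodule.smul_mem_smul (h _) Submodule.mem_top

lemma exists_dual_apply_notMem (p : PrimeSpectrum R) (hp : 0 < Module.rankAtStalk P p) :
    ∃ (φ : Module.Dual R P) (x : P), φ x ∉ p.asIdeal := by
  by_contra! h
  obtain ⟨r, hr, hr'⟩ := Submodule.exists_sub_one_mem_and_smul_eq_zero_of_fg_of_le_smul
    p.asIdeal (⊤ : Submodule R P) Module.Finite.fg_top
    (fun y _ => mem_smul_top_of_forall_dual fun φ => h φ y)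
  rw [Module.rankAtStalk_pos_iff_mem_support, Module.mem_support_iff_exists_annihilator] at hp
  obtain ⟨y, hy⟩ := hp
  have hrp : r ∈ p.asIdeal := hy ((Submodule.mem_annihilator_span_singleton y r).2
    (hr' y Submodule.mem_top))
  exact p.2.ne_top ((Ideal.eq_top_iff_one _).2 (by simpa using sub_mem hrp hr))

omit [Module.Finite R P] [Module.Projective R P] in
/-- If a multiple `r • P` with `r ∉ p` is contained in a cyclic submodule, then `P` has rank at
most `1` at `p`. -/
lemma rankAtStalk_le_one (p : PrimeSpectrum R) {r : R} (hr : r ∉ p.asIdeal) (x : P)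
    (h : ∀ y : P, ∃ c : R, r • y = c • x) : Module.rankAtStalk P p ≤ 1 := by
  refine finrank_le_one (LocalizedModule.mk x 1) fun w => ?_
  induction w using LocalizedModule.induction_on with
  | h y s =>
    obtain ⟨c, hc⟩ := h y
    refine ⟨Localization.mk c (⟨r, hr⟩ * s), ?_⟩
    rw [LocalizedModule.mk_smul_mk, LocalizedModule.mk_eq]
    refine ⟨1, ?_⟩
    simp only [one_smul, mul_one, ← hc, Submonoid.smul_def, Submonoid.coe_mul]
    module

/-- A projective module of rank at least `2` at the maximal ideal `𝔪` has two biorthogonal pairs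
of a vector and a functional that are non-degenerate modulo `𝔪`. -/
lemma exists_biorthogonal_pairs (p : PrimeSpectrum R) (hpm : p.asIdeal.IsMaximal)
    (hp : 2 ≤ Module.rankAtStalk P p) :
    ∃ (f g : Module.Dual R P) (x y : P), f x ∉ p.asIdeal ∧ g y ∉ p.asIdeal ∧ f y = 0 ∧ g x = 0 := by
  obtain ⟨f, x, hfx⟩ := exists_dual_apply_notMem (P := P) p (by omega)
  suffices h : ∃ (g : Module.Dual R P) (y : P), f y = 0 ∧ g y ∉ p.asIdeal by
    obtain ⟨g, y, hy, hgy⟩ := h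
    refine ⟨f, f x • g - g x • f, x, y, hfx, ?_, hy, ?_⟩
    · simpa [hy] using p.2.mul_notMem hfx hgy
    · simp [mul_comm]
  by_contra! hK
  have hker : ∀ y, f y = 0 → y ∈ p.asIdeal • (⊤ : Submodule R P) := fun y hy =>
    mem_smul_top_of_forall_dual fun g => hK g y hy
  -- By Nakayama's lemma, `P / Rx` vanishes at `𝔪`.
  obtain ⟨b, hb⟩ := hpm.exists_inv hfx
  obtain ⟨i, hi, hbi⟩ := hb
  let π := (Submodule.span R {x}).mkQ
  have hx0 : π x = 0 := by
    rw [Submodule.mkQ_apply, Submodule.Quotient.mk_eq_zero]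
    exact Submodule.mem_span_singleton_self x
  have hle : (⊤ : Submodule R (P ⧸ Submodule.span R {x})) ≤ p.asIdeal • ⊤ := by
    rintro z -
    obtain ⟨y, rfl⟩ := Submodule.mkQ_surjective _ z
    have h1 : f x • y - f y • x ∈ p.asIdeal • (⊤ : Submodule R P) := hker _ (by simp [mul_comm])
    have h2 : π (f x • y - f y • x) ∈ p.asIdeal • (⊤ : Submodule R (P ⧸ Submodule.span R {x})) := by
      have := Submodule.mem_map_of_mem (f := π) h1
      rw [Submodule.map_smul''] at this
      exact Submodule.smul_mono le_rfl le_top this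
    rw [map_sub, map_smul, map_smul, hx0, smul_zero, sub_zero] at h2
    have h3 : π y = b • f x • π y + i • π y := by
      rw [smul_smul, ← add_smul, hbi, one_smul]
    rw [h3]
    exact add_mem (Submodule.smul_mem _ _ h2) (Submodule.smul_mem_smul hi Submodule.mem_top)
  obtain ⟨r, hr, hr'⟩ := Submodule.exists_sub_one_mem_and_smul_eq_zero_of_fg_of_le_smul
    p.asIdeal _ Module.Finite.fg_top hle
  have hrp : r ∉ p.asIdeal := fun h =>
    p.2.ne_top ((Ideal.eq_top_iff_one _).2 (by simpa using sub_mem h hr))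
  have := rankAtStalk_le_one p hrp x fun y => by
    have h1 : π (r • y) = 0 := by rw [map_smul]; exact hr' _ Submodule.mem_top
    rw [Submodule.mkQ_apply, Submodule.Quotient.mk_eq_zero, Submodule.mem_span_singleton] at h1
    obtain ⟨c, hc⟩ := h1
    exact ⟨c, hc.symm⟩
  omega

end Projective

section Standard

/-- Every column of the standard matrix is a unit multiple of a standard basis vector. -/
lemma exists_smul_stdMatrix_row (S : Type*) [CommRing S] [Invertible (2 : S)] (N : ℕ)
    (j : Fin N) : ∃ (k : Fin N) (t : S), ∀ j',
      t * stdMatrix S N k j' = if j' = j then 1 else 0 := by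
  by_cases hN : Even N
  · have hN2 := Nat.even_iff.1 hN
    have hj := j.2
    by_cases hj2 : (j : ℕ) % 2 = 0
    · refine ⟨⟨j + 1, by omega⟩, 1, fun j' => ?_⟩
      have : (((j : ℕ) + 1) / 2 = (j' : ℕ) / 2 ∧ (j : ℕ) + 1 ≠ j') ↔ (j' : ℕ) = j := by omega
      simp only [stdMatrix, hN, if_true, one_mul, ne_eq, Fin.ext_iff, this]
    · refine ⟨⟨j - 1, by omega⟩, 1, fun j' => ?_⟩
      have : (((j : ℕ) - 1) / 2 = (j' : ℕ) / 2 ∧ (j : ℕ) - 1 ≠ j') ↔ (j' : ℕ) = j := by omega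
      simp only [stdMatrix, hN, if_true, one_mul, ne_eq, Fin.ext_iff, this]
  · have hN2 := Nat.not_even_iff.1 hN
    have hj := j.2
    by_cases hj0 : (j : ℕ) = 0
    · refine ⟨j, ⅟2, fun j' => ?_⟩
      by_cases hj' : (j' : ℕ) = 0
      · simp [stdMatrix, hN, hj0, hj', Fin.ext_iff]
      · have : ¬((0 + 1) / 2 = ((j' : ℕ) + 1) / 2 ∧ ¬(0 = (j' : ℕ))) := by omega
        simp only [stdMatrix, hN, hj0, hj', Fin.ext_iff, if_false, and_false, ne_eq, this, mul_zero]
    · by_cases hj2 : (j : ℕ) % 2 = 0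
      · refine ⟨⟨j - 1, by omega⟩, 1, fun j' => ?_⟩
        have : (((j : ℕ) - 1 + 1) / 2 = ((j' : ℕ) + 1) / 2 ∧ (j : ℕ) - 1 ≠ j') ↔
          (j' : ℕ) = j := by omega
        have h0 : ¬((j : ℕ) - 1 = 0 ∧ (j' : ℕ) = 0) := by omega
        simp only [stdMatrix, hN, if_false, one_mul, ne_eq, Fin.ext_iff, this, h0]
      · refine ⟨⟨j + 1, by omega⟩, 1, fun j' => ?_⟩
        have : (((j : ℕ) + 1 + 1) / 2 = ((j' : ℕ) + 1) / 2 ∧ (j : ℕ) + 1 ≠ j') ↔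
          (j' : ℕ) = j := by omega
        have h0 : ¬((j : ℕ) + 1 = 0 ∧ (j' : ℕ) = 0) := by omega
        simp only [stdMatrix, hN, if_false, one_mul, ne_eq, Fin.ext_iff, this, h0]

variable {M : Type*} [AddCommGroup M] [Module R M]

/-- If `(M, q)` is locally standard, then `M → M*`, `z ↦ ⟨z, ·⟩`, is surjective. -/
lemma form_surjective_of_isStandardAt [Invertible (2 : R)] [Module.Finite R M]
    {q : QuadraticForm R M} {N : ℕ}
    (h : ∀ (𝔪 : Ideal R) [𝔪.IsMaximal], IsStandardAt q 𝔪 N) :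
    Function.Surjective (form q) := by
  intro φ
  suffices hJ : (LinearMap.range (form q)).comap (LinearMap.toSpanSingleton R _ φ) = ⊤ by
    have h1 : (1 : R) ∈ (LinearMap.range (form q)).comap (LinearMap.toSpanSingleton R _ φ) :=
      hJ ▸ Submodule.mem_top
    simpa using h1
  refine ideal_eq_top_of_forall_maximal fun 𝔪 hm => ?_
  let S := Localization.AtPrime 𝔪
  obtain ⟨b, hb⟩ := h 𝔪
  have : Invertible (2 : S) := by
    have := Invertible.map (algebraMap R S) 2
    rwa [map_ofNat] at this
  choose k t hkt using exists_smul_stdMatrix_row S N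
  -- The vector representing `φ` over the localization.
  let φS : Module.Dual S (S ⊗[R] M) := Module.Dual.baseChange S φ
  let y : S ⊗[R] M := ∑ j, (φS (b j) * t j) • b (k j)
  have hy : LinearMap.BilinForm.baseChange S (form q) y = φS := by
    refine b.ext fun j' => ?_
    simp only [y, map_sum, LinearMap.sum_apply, map_smul, LinearMap.smul_apply]
    refine (Finset.sum_congr rfl fun j _ => ?_).trans (Finset.sum_ite_eq Finset.univ j'
      fun j => φS (b j)) |>.trans (by simp)
    rw [hb, smul_eq_mul, mul_assoc, hkt, mul_ite, mul_one, mul_zero]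
  obtain ⟨⟨y₀, s⟩, hs⟩ := IsLocalizedModule.surj 𝔪.primeCompl (TensorProduct.mk R S M 1) y
  have hloc : ∀ x : M, algebraMap R S (form q y₀ x) = algebraMap R S (s * φ x) := by
    intro x
    have h1 := LinearMap.congr_fun hy (1 ⊗ₜ[R] x)
    have h2 : LinearMap.BilinForm.baseChange S (form q) (1 ⊗ₜ[R] y₀) (1 ⊗ₜ[R] x) =
        algebraMap R S s * φS (1 ⊗ₜ[R] x) := by
      have hs' : (1 : S) ⊗ₜ[R] y₀ = algebraMap R S s • y := by
        rw [algebraMap_smul]; exact hs.symm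
      rw [hs', map_smul, LinearMap.smul_apply, h1, smul_eq_mul]
    rw [LinearMap.BilinForm.baseChange_tmul] at h2
    simp only [φS, Module.Dual.baseChange_apply_tmul, mul_one, Algebra.smul_def] at h2
    rw [h2, map_mul]
  obtain ⟨T, hT⟩ := (Module.Finite.fg_top : (⊤ : Submodule R M).FG)
  choose c hc using fun x => IsLocalization.exists_of_eq (M := 𝔪.primeCompl) (hloc x)
  -- A common denominator for a finite set of generators.
  let d : 𝔪.primeCompl := ∏ x ∈ T, c x
  refine ⟨d * s, ⟨(d : R) • y₀, ?_⟩, (d * s).2⟩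
  refine LinearMap.ext_on hT fun x hx => ?_
  obtain ⟨e, he⟩ : c x ∣ d := Finset.dvd_prod_of_mem c hx
  have h1 := hc x
  simp only [he, map_smul, LinearMap.smul_apply, LinearMap.toSpanSingleton_apply, smul_eq_mul,
    Submonoid.coe_mul]
  linear_combination (e : R) * h1

end Standard

end LocalAlgebra

/-! ### Hyperbolic pairs, totally isotropic submodules and exponentials -/

section HyperbolicPairs

variable {R : Type*} [CommRing R] {M : Type*} [AddCommGroup M] [Module R M]
  {q : QuadraticForm R M} {I : Ideal R} {H N : Subgroup (M ≃ₗ[R] M)}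

local notation "𝓓" => transvectionModule q I H N

/-- The orthogonal complement of two pairs of vectors. -/
def pairsComplement (q : QuadraticForm R M) (e f : Fin 2 → M) : Submodule R M :=
  (⨅ i, LinearMap.ker (form q (e i))) ⊓ ⨅ i, LinearMap.ker (form q (f i))

lemma mem_pairsComplement {e f : Fin 2 → M} {v : M} :
    v ∈ pairsComplement q e f ↔ (∀ i, form q (e i) v = 0) ∧ ∀ i, form q (f i) v = 0 := by
  simp only [pairsComplement, Submodule.mem_inf, Submodule.mem_iInf, LinearMap.mem_ker]

lemma le_transvectionModule_of_mem_span_pair {e₀ e₁ x : M} (h₀ : q e₀ = 0) (h₁ : q e₁ = 0)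
    (h : form q e₀ e₁ = 0)
    (H₀ : ∀ v, form q e₀ v = 0 → v ∈ 𝓓 e₀) (H₁ : ∀ v, form q e₁ v = 0 → v ∈ 𝓓 e₁)
    (hx : x ∈ Submodule.span R {e₀, e₁}) {w : M} (hw₀ : form q e₀ w = 0) (hw₁ : form q e₁ w = 0) :
    w ∈ 𝓓 x := by
  obtain ⟨a, b, rfl⟩ := Submodule.mem_span_pair.1 hx
  refine mem_transvectionModule_add_left (by rw [q_smul, h₀, mul_zero])
    (by rw [q_smul, h₁, mul_zero]) (mem_transvectionModule_smul_left h₀ a (H₀ w hw₀))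
    (mem_transvectionModule_smul_left h₁ b (H₁ w hw₁)) ?_ ?_
  · simp only [map_smul, LinearMap.smul_apply, h, smul_zero]
  · exact Submodule.smul_mem _ _ (Submodule.smul_mem _ _
      (mem_transvectionModule_smul_left h₀ a (H₀ e₁ h)))

lemma isotropic_of_mem_span_pair {e₀ e₁ x : M} (h₀ : q e₀ = 0) (h₁ : q e₁ = 0)
    (h : form q e₀ e₁ = 0) (hx : x ∈ Submodule.span R {e₀, e₁}) : q x = 0 := by
  obtain ⟨a, b, rfl⟩ := Submodule.mem_span_pair.1 hx
  simp only [q_add, q_smul, map_smul, LinearMap.smul_apply, h₀, h₁, h]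
  simp

lemma form_eq_zero_of_mem_span_pair {e₀ e₁ x w : M} (hw₀ : form q e₀ w = 0)
    (hw₁ : form q e₁ w = 0) (hx : x ∈ Submodule.span R {e₀, e₁}) : form q x w = 0 := by
  obtain ⟨a, b, rfl⟩ := Submodule.mem_span_pair.1 hx
  simp only [map_add, map_smul, LinearMap.add_apply, LinearMap.smul_apply, hw₀, hw₁]
  simp

/-- Two orthogonal hyperbolic pairs and their complement form a frame, if all transvections
`σ_{u,v}` with `u` unimodular are available. -/
lemma eichlerFrame_of_pairs (hN : ∀ h ∈ H, ∀ n ∈ N, h * n * h⁻¹ ∈ N)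
    (hU : ∀ u v, IsUnimodular R u → q u = 0 → form q u v = 0 → v ∈ 𝓓 u)
    {e f : Fin 2 → M} (he : ∀ i, q (e i) = 0) (hf : ∀ i, q (f i) = 0)
    (hef : ∀ i j, form q (e i) (f j) = if i = j then 1 else 0)
    (hee : ∀ i j, i ≠ j → form q (e i) (e j) = 0) (hff : ∀ i j, i ≠ j → form q (f i) (f j) = 0)
    (hC : Ideal.span {r | ∃ w ∈ pairsComplement q e f, ∃ w' ∈ pairsComplement q e f,
      r = form q w w'} = ⊤) :
    EichlerFrame q I H N (Submodule.span R {e 0, e 1}) (Submodule.span R {f 0, f 1})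
      (pairsComplement q e f) := by
  have hfe : ∀ i j, form q (f i) (e j) = if i = j then 1 else 0 := fun i j => by
    rw [form_comm, hef]; simp only [eq_comm]
  have hee' : ∀ i j, form q (e i) (e j) = 0 := fun i j => by
    rcases eq_or_ne i j with rfl | h
    exacts [form_self_of_isotropic q (he i), hee i j h]
  have hff' : ∀ i j, form q (f i) (f j) = 0 := fun i j => by
    rcases eq_or_ne i j with rfl | h
    exacts [form_self_of_isotropic q (hf i), hff i j h]
  have eU : ∀ i v, form q (e i) v = 0 → v ∈ 𝓓 (e i) := fun i v =>
    hU _ _ ⟨form q (f i), by rw [hfe, if_pos rfl]⟩ (he i)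
  have fU : ∀ i v, form q (f i) v = 0 → v ∈ 𝓓 (f i) := fun i v =>
    hU _ _ ⟨form q (e i), by rw [hef, if_pos rfl]⟩ (hf i)
  have e_mem : ∀ i, e i ∈ Submodule.span R {e 0, e 1} := fun i =>
    Submodule.subset_span (by fin_cases i <;> simp)
  have f_mem : ∀ i, f i ∈ Submodule.span R {f 0, f 1} := fun i =>
    Submodule.subset_span (by fin_cases i <;> simp)
  exact
  { conj_mem := hN
    isotropic_left := fun x => isotropic_of_mem_span_pair (he 0) (he 1) (hee' 0 1)
    isotropic_right := fun x => isotropic_of_mem_span_pair (hf 0) (hf 1) (hff' 0 1)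
    form_left := fun x hx w hw => form_eq_zero_of_mem_span_pair
      ((mem_pairsComplement.1 hw).1 0) ((mem_pairsComplement.1 hw).1 1) hx
    form_right := fun x hx w hw => form_eq_zero_of_mem_span_pair
      ((mem_pairsComplement.1 hw).2 0) ((mem_pairsComplement.1 hw).2 1) hx
    le_left := fun x hx w hw => le_transvectionModule_of_mem_span_pair (he 0) (he 1) (hee' 0 1)
      (eU 0) (eU 1) hx ((mem_pairsComplement.1 hw).1 0) ((mem_pairsComplement.1 hw).1 1)
    le_right := fun x hx w hw => le_transvectionModule_of_mem_span_pair (hf 0) (hf 1) (hff' 0 1)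
      (fU 0) (fU 1) hx ((mem_pairsComplement.1 hw).2 0) ((mem_pairsComplement.1 hw).2 1)
    sup_eq_top := by
      refine eq_top_iff.2 fun v _ => ?_
      let a := ∑ i, form q (f i) v • e i
      let b := ∑ i, form q (e i) v • f i
      have hab : v = a + b + (v - (a + b)) := by abel
      rw [hab]
      refine add_mem (Submodule.mem_sup_left (add_mem
        (Submodule.mem_sup_left (sum_mem fun i _ => Submodule.smul_mem _ _ (e_mem i)))
        (Submodule.mem_sup_right (sum_mem fun i _ => Submodule.smul_mem _ _ (f_mem i)))))
        (Submodule.mem_sup_right (mem_pairsComplement.2 ⟨fun i => ?_, fun i => ?_⟩))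
      · simp only [a, b, map_sub, map_add, map_sum, map_smul, hee', hef, smul_eq_mul, mul_zero,
          mul_ite, mul_one, Finset.sum_const_zero, Finset.sum_ite_eq, Finset.mem_univ, if_true]
        ring
      · simp only [a, b, map_sub, map_add, map_sum, map_smul, hff', hfe, smul_eq_mul, mul_zero,
          mul_ite, mul_one, Finset.sum_const_zero, Finset.sum_ite_eq, Finset.mem_univ, if_true]
        ring
    span_form := hC
    span_pairing := by
      refine (Ideal.eq_top_iff_one _).2 (Ideal.subset_span ⟨e 0, e_mem 0, f 0, f_mem 0, ?_⟩)
      rw [hfe, if_pos rfl]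
    span_left := by
      refine Submodule.span_le.2 ?_
      rintro x (rfl | rfl)
      · exact Submodule.subset_span ⟨e 1, e_mem 1, e 0, e_mem 0, f 1, f_mem 1, by
          simp [bracket, hfe]⟩
      · exact Submodule.subset_span ⟨e 0, e_mem 0, e 1, e_mem 1, f 0, f_mem 0, by
          simp [bracket, hfe]⟩
    span_right := by
      refine Submodule.span_le.2 ?_
      rintro x (rfl | rfl)
      · exact Submodule.subset_span ⟨f 1, f_mem 1, f 0, f_mem 0, e 1, e_mem 1, by
          simp [bracket, hef]⟩
      · exact Submodule.subset_span ⟨f 0, f_mem 0, f 1, f_mem 1, e 0, e_mem 0, by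
          simp [bracket, hef]⟩ }

/-- In the presence of a frame, the vectors of a totally isotropic submodule `A` whose pairing with
`M` generates the unit ideal need not be unimodular: a vector `x` of `A` is `(x + x') - x'`, and
for `a = ⟨x', y⟩` all terms have enough multiples of the given vector in their modules. -/
lemma EichlerFrame.mem_of_totally_isotropic [Invertible (2 : R)] {A₀ B₀ C₀ A : Submodule R M}
    (F : EichlerFrame q I H N A₀ B₀ C₀) (hA : ∀ x ∈ A, q x = 0)
    (hspan : Ideal.span {r | ∃ x ∈ A, ∃ y, r = form q x y} = ⊤) {x w : M} (hx : x ∈ A)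
    (hw : ∀ x' ∈ A, form q x' w = 0) : w ∈ 𝓓 x := by
  have hAA : ∀ x ∈ A, ∀ x' ∈ A, form q x x' = 0 := fun x hx x' hx' => by
    have h := q_add q x x'
    rw [hA _ (A.add_mem hx hx'), hA _ hx, hA _ hx'] at h
    simpa using h.symm
  have key : ∀ x' ∈ A, ∀ y, (form q x' y * form q x' y) • w ∈ 𝓓 x := by
    intro x' hx' y
    have hxx' := A.add_mem hx hx'
    have h1 := F.form_smul_mem (hA x hx) (hw x hx) y
    have h2 := F.form_smul_mem (hA _ hxx') (hw _ hxx') y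
    have h3 := F.form_smul_mem (hA _ (A.neg_mem hx')) (hw _ (A.neg_mem hx')) y
    have h4 := F.form_smul_mem (hA _ hxx') (hAA _ hxx' _ (A.neg_mem hx')) y
    simp only [map_add, map_neg, LinearMap.add_apply, LinearMap.neg_apply] at h2 h3 h4
    set c := form q x y
    set a := form q x' y
    have h5 : (a * (c + a)) • w ∈ 𝓓 (x + x' + -x') := by
      refine mem_transvectionModule_add_left (hA _ hxx') (hA _ (A.neg_mem hx')) ?_ ?_
        (hAA _ hxx' _ (A.neg_mem hx')) ?_
      · rw [mul_smul]
        exact Submodule.smul_mem _ _ h2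
      · convert Submodule.smul_mem _ (-(c + a)) h3 using 1
        module
      · convert Submodule.smul_mem _ (a * a * (c + a) * q w) h4 using 1
        rw [q_smul]
        module
    rw [add_neg_cancel_right] at h5
    convert sub_mem h5 (Submodule.smul_mem _ a h1) using 1
    module
  refine mem_of_span_eq_top (S := {r | r • w ∈ 𝓓 x}) ?_ fun r hr => hr
  refine ideal_eq_top_of_forall_maximal fun 𝔪 hm => ?_
  by_contra! h
  refine hm.ne_top (top_le_iff.1 (hspan ▸ Ideal.span_le.2 ?_))
  rintro _ ⟨x', hx', y, rfl⟩
  exact or_self_iff.1 (hm.isPrime.mem_or_mem (h _ (Ideal.subset_span (key x' hx' y))))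

end HyperbolicPairs

section Exponential

variable {R : Type*} [CommRing R] {M : Type*} [AddCommGroup M] [Module R M]

/-- The skew-symmetric endomorphism `y ↦ ⟨w,y⟩x - ⟨x,y⟩w`. -/
def skew (q : QuadraticForm R M) (w x : M) : M →ₗ[R] M :=
  (form q w).smulRight x - (form q x).smulRight w

variable {q : QuadraticForm R M}

lemma skew_apply (w x y : M) : skew q w x y = form q w y • x - form q x y • w := rfl

/-- The additive monoid generated by the `y ↦ a(⟨w,y⟩x - ⟨x,y⟩w)` with `a ∈ I`, `w ∈ C` and
`x ∈ A`. -/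
def skewMonoid (q : QuadraticForm R M) (I : Ideal R) (A C : Submodule R M) :
    AddSubmonoid (M →ₗ[R] M) :=
  AddSubmonoid.closure {S | ∃ a ∈ I, ∃ w ∈ C, ∃ x ∈ A, S = a • skew q w x}

lemma skew_mem_skewMonoid {I : Ideal R} {A C : Submodule R M} {P : Type*} [AddCommGroup P]
    [Module R P] (j : P →ₗ[R] M) (hj : ∀ y, j y ∈ A) {w : M} (hw : w ∈ C) {y : P}
    (hy : y ∈ I • (⊤ : Submodule R P)) : skew q w (j y) ∈ skewMonoid q I A C := by
  refine Submodule.smul_induction_on hy (fun a ha y _ => ?_) fun y y' hy hy' => ?_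
  · refine AddSubmonoid.subset_closure ⟨a, ha, w, hw, j y, hj y, ?_⟩
    ext z
    simp only [skew_apply, map_smul, LinearMap.smul_apply, smul_eq_mul]
    module
  · convert add_mem hy hy' using 1
    ext z
    simp only [skew_apply, map_add, LinearMap.add_apply]
    module

variable [Invertible (2 : R)] {I : Ideal R} {H N : Subgroup (M ≃ₗ[R] M)}

local notation "𝓓" => transvectionModule q I H N

/-- The exponentials `1 + S + S²/2` of the elements `S` of `skewMonoid` lie in `N`: for
`S₀ = a(⟨w,·⟩x - ⟨x,·⟩w)`, the exponential of `S₀ + S` is the product of those of `S`, of `S₀` and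
of `-[S, S₀]/2`, where the second one is `σ_{x,aw}` and the third one is `σ_{x,v}` with
`v = -(a/2) S w`. -/
lemma exists_exp_of_mem_skewMonoid {A C : Submodule R M} (hA : ∀ x ∈ A, q x = 0)
    (hAC : ∀ x ∈ A, ∀ w ∈ C, form q x w = 0) (hAD : ∀ x ∈ A, A ≤ 𝓓 x) (hCD : ∀ x ∈ A, C ≤ 𝓓 x)
    {S : M →ₗ[R] M} (hS : S ∈ skewMonoid q I A C) :
    ∃ g ∈ N, ∀ y, g y = y + S y + (⅟2 : R) • S (S y) := by
  have hAA : ∀ x ∈ A, ∀ x' ∈ A, form q x x' = 0 := fun x hx x' hx' =>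
    form_eq_zero_of_mem (hA x hx) (hAD x hx hx')
  suffices h : (∀ x ∈ A, S x = 0) ∧ (∀ w ∈ C, S w ∈ A) ∧
      (∀ y z, form q (S y) z = -form q y (S z)) ∧
      ∃ g ∈ N, ∀ y, g y = y + S y + (⅟2 : R) • S (S y) from h.2.2.2
  have h2 : (2 : R) * ⅟2 = 1 := mul_invOf_self _
  refine AddSubmonoid.closure_induction_left ?_ ?_ hS
  · exact ⟨fun _ _ => rfl, fun _ _ => A.zero_mem, fun y z => by simp, 1, N.one_mem,
      fun y => by simp⟩
  · rintro _ ⟨a, ha, w, hw, x, hx, rfl⟩ S - ⟨hSA, hSC, hskew, g, hgN, hg⟩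
    refine ⟨fun x' hx' => ?_, fun w' hw' => ?_, fun y z => ?_, ?_⟩
    · simp [skew_apply, hSA x' hx', hAA x hx x' hx', (form_comm q w x').trans (hAC x' hx' w hw)]
    · refine add_mem ?_ (hSC w' hw')
      simp only [LinearMap.smul_apply, skew_apply, hAC x hx w' hw', zero_smul, sub_zero]
      exact A.smul_mem _ (A.smul_mem _ hx)
    · simp only [LinearMap.add_apply, LinearMap.smul_apply, skew_apply, map_add, map_smul, map_sub,
        LinearMap.sub_apply, hskew, smul_eq_mul, form_comm q y x, form_comm q y w]
      ring
    · have hxq := hA x hx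
      have hSw := hSC w hw
      obtain ⟨g₀, hg₀, -, hg₀N⟩ := ((mem_transvectionModule hxq).1 (hCD x hx hw)).2 a
      obtain ⟨g₁, hg₁, -, hg₁N⟩ := ((mem_transvectionModule hxq).1 (hAD x hx
        (A.smul_mem (-⅟2 : R) hSw))).2 a
      refine ⟨g * g₀ * g₁, N.mul_mem (N.mul_mem hgN (hg₀N ha)) (hg₁N ha), fun y => ?_⟩
      have e1 := hSA x hx
      have e2 := hSA _ hSw
      have e3 := hA _ hSw
      have e4 := hAC x hx w hw
      have e5 := hAA x hx _ hSw
      have e6 := hAC _ hSw w hw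
      have e7 : form q x (S y) = 0 := by
        have := hskew x y
        rw [e1, map_zero, LinearMap.zero_apply] at this
        simpa using this.symm
      have e8 : form q w (S y) = -form q (S w) y := by rw [hskew, neg_neg]
      have e9 := (form_comm q w _).trans e6
      have e10 := (form_comm q w x).trans e4
      have e11 := form_self_of_isotropic q hxq
      rw [LinearEquiv.mul_apply, LinearEquiv.mul_apply, hg₁, hg₀, hg]
      simp only [esd, LinearMap.add_apply, LinearMap.smul_apply, skew_apply, map_add, map_sub,
        map_smul, smul_eq_mul, q_smul, e1, e2, e3, e4, e5, e7, e8, e9, e10,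
        e11, form_self, map_zero, smul_zero]
      match_scalars
      · ring
      · linear_combination (a ^ 2 * form q x y * q w) * h2
      · linear_combination (a * form q x y) * h2
      · ring
      · ring
      · ring

end Exponential

/-! ### The summands of the orthogonal sum with a hyperbolic space -/

section NormalClosure

variable {G : Type*} [Group G] {H K : Subgroup G} {S : Set H}

lemma conj_mem_map_normalClosure {h n : G} (hh : h ∈ H)
    (hn : n ∈ (Subgroup.normalClosure S).map H.subtype) :
    h * n * h⁻¹ ∈ (Subgroup.normalClosure S).map H.subtype := by
  obtain ⟨n, hn, rfl⟩ := hn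
  exact ⟨⟨h, hh⟩ * n * ⟨h, hh⟩⁻¹, Subgroup.normalClosure_normal.conj_mem n hn _, rfl⟩

lemma mem_map_normalClosure {g : H} (hg : g ∈ S) :
    (g : G) ∈ (Subgroup.normalClosure S).map H.subtype :=
  ⟨g, Subgroup.subset_normalClosure hg, rfl⟩

lemma map_normalClosure_le (hS : ∀ s ∈ S, (s : G) ∈ K)
    (hK : ∀ h ∈ H, ∀ k ∈ K, h * k * h⁻¹ ∈ K) :
    (Subgroup.normalClosure S).map H.subtype ≤ K := by
  have : (K.subgroupOf H).Normal := ⟨fun n hn g => hK g g.2 n hn⟩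
  rw [Subgroup.map_le_iff_le_comap]
  exact Subgroup.normalClosure_le_normal (N := K.subgroupOf H) hS

lemma map_normalClosure_le_left : (Subgroup.normalClosure S).map H.subtype ≤ H :=
  Subgroup.map_subtype_le _

end NormalClosure

section OrthogonalSum

variable {R : Type*} [CommRing R] {Q P : Type*}
  [AddCommGroup Q] [Module R Q] [AddCommGroup P] [Module R P] {q : QuadraticForm R Q}

lemma sumForm_apply (v : Q × (P × Module.Dual R P)) :
    sumForm q P v = q v.1 + v.2.2 v.2.1 := rfl

lemma form_sumForm (v w : Q × (P × Module.Dual R P)) :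
    form (sumForm q P) v w = form q v.1 w.1 + (v.2.2 w.2.1 + w.2.2 v.2.1) := by
  simp only [form, QuadraticMap.polarBilin_apply_apply, QuadraticMap.polar, sumForm_apply,
    Prod.fst_add, Prod.snd_add, LinearMap.add_apply, map_add]
  ring

variable (R Q P) in
/-- The summand `Q` of `Q ⊥ H(P)`. -/
def summandQ : Submodule R (Q × (P × Module.Dual R P)) := Submodule.prod ⊤ ⊥

variable (R Q P) in
/-- The summand `P` of `Q ⊥ H(P)`. -/
def summandP : Submodule R (Q × (P × Module.Dual R P)) := Submodule.prod ⊥ (Submodule.prod ⊤ ⊥)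

variable (R Q P) in
/-- The summand `P*` of `Q ⊥ H(P)`. -/
def summandDual : Submodule R (Q × (P × Module.Dual R P)) :=
  Submodule.prod ⊥ (Submodule.prod ⊥ ⊤)

lemma mem_summandQ {v : Q × (P × Module.Dual R P)} :
    v ∈ summandQ R Q P ↔ ∃ z, v = (z, 0, 0) := by
  obtain ⟨z, x, f⟩ := v
  simp [summandQ, Submodule.mem_prod, Prod.ext_iff]

lemma mem_summandP {v : Q × (P × Module.Dual R P)} :
    v ∈ summandP R Q P ↔ ∃ x, v = (0, x, 0) := by
  obtain ⟨z, x, f⟩ := v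
  simp [summandP, Submodule.mem_prod, Prod.ext_iff]

lemma mem_summandDual {v : Q × (P × Module.Dual R P)} :
    v ∈ summandDual R Q P ↔ ∃ f, v = (0, 0, f) := by
  obtain ⟨z, x, f⟩ := v
  simp [summandDual, Submodule.mem_prod, Prod.ext_iff]

lemma isotropic_of_mem_summandP : ∀ v ∈ summandP R Q P, sumForm q P v = 0 := by
  intro v hv
  obtain ⟨x, rfl⟩ := mem_summandP.1 hv
  simp [sumForm_apply]

lemma isotropic_of_mem_summandDual : ∀ v ∈ summandDual R Q P, sumForm q P v = 0 := by
  intro v hv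
  obtain ⟨f, rfl⟩ := mem_summandDual.1 hv
  simp [sumForm_apply]

lemma form_summandP_summandQ :
    ∀ v ∈ summandP R Q P, ∀ w ∈ summandQ R Q P, form (sumForm q P) v w = 0 := by
  intro v hv w hw
  obtain ⟨x, rfl⟩ := mem_summandP.1 hv
  obtain ⟨z, rfl⟩ := mem_summandQ.1 hw
  simp only [form_sumForm]
  simp

lemma form_summandDual_summandQ :
    ∀ v ∈ summandDual R Q P, ∀ w ∈ summandQ R Q P, form (sumForm q P) v w = 0 := by
  intro v hv w hw
  obtain ⟨f, rfl⟩ := mem_summandDual.1 hv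
  obtain ⟨z, rfl⟩ := mem_summandQ.1 hw
  simp only [form_sumForm]
  simp

section Finite

variable [Module.Finite R P] [Module.Projective R P]

/-- The values of the bilinear form of `Q` generate the unit ideal: otherwise `Q` would vanish at
some maximal ideal, and `M` would have rank `2m` there. -/
lemma span_form_eq_top [Module.Finite R Q] [Module.Projective R Q] {n m : ℕ} (hn : 1 ≤ n)
    (hP : ∀ p : PrimeSpectrum R, Module.rankAtStalk P p = m)
    (hstd : ∀ (𝔪 : Ideal R) [𝔪.IsMaximal], IsStandardAt (sumForm q P) 𝔪 (n + 2 * m))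
    (hd : Function.Surjective (form q)) :
    Ideal.span {r | ∃ z z' : Q, r = form q z z'} = ⊤ := by
  refine ideal_eq_top_of_forall_maximal fun 𝔪 hm => ?_
  let p : PrimeSpectrum R := ⟨𝔪, hm.isPrime⟩
  have : Nontrivial (Localization.AtPrime 𝔪) := inferInstance
  have hrank : Module.rankAtStalk (Q × (P × Module.Dual R P)) p = n + 2 * m := by
    obtain ⟨b, -⟩ := hstd 𝔪
    rw [Module.rankAtStalk_eq_finrank_tensorProduct]
    exact (Module.finrank_eq_card_basis b).trans (Fintype.card_fin _)
  rw [Module.rankAtStalk_prod, Module.rankAtStalk_prod, Pi.add_apply, Pi.add_apply,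
    rankAtStalk_dual, hP] at hrank
  obtain ⟨φ, z, hz⟩ := exists_dual_apply_notMem (P := Q) p (by omega)
  obtain ⟨w, rfl⟩ := hd φ
  exact ⟨_, Ideal.subset_span ⟨w, z, rfl⟩, hz⟩

variable (hP : ∀ p : PrimeSpectrum R, 2 ≤ Module.rankAtStalk P p)
include hP

lemma span_pairing_eq_top :
    Ideal.span {r | ∃ (f : Module.Dual R P) (x : P), r = f x} = ⊤ := by
  refine ideal_eq_top_of_forall_maximal fun 𝔪 hm => ?_
  obtain ⟨f, x, h⟩ := exists_dual_apply_notMem (P := P) ⟨𝔪, hm.isPrime⟩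
    (lt_of_lt_of_le two_pos (hP _))
  exact ⟨_, Ideal.subset_span ⟨f, x, rfl⟩, h⟩

lemma summandP_le_span : summandP R Q P ≤ Submodule.span R {p | ∃ x ∈ summandP R Q P,
    ∃ x' ∈ summandP R Q P, ∃ f ∈ summandDual R Q P, p = bracket (sumForm q P) f x x'} := by
  intro v hv
  obtain ⟨x₀, rfl⟩ := mem_summandP.1 hv
  set N := Submodule.span R {p | ∃ x ∈ summandP R Q P,
    ∃ x' ∈ summandP R Q P, ∃ f ∈ summandDual R Q P, p = bracket (sumForm q P) f x x'}
  have hN : ∀ (f : Module.Dual R P) (x x' : P), ((0, f x • x' - f x' • x, 0) : Q × _ × _) ∈ N := by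
    intro f x x'
    refine Submodule.subset_span ⟨(0, x, 0), mem_summandP.2 ⟨_, rfl⟩, (0, x', 0),
      mem_summandP.2 ⟨_, rfl⟩, (0, 0, f), mem_summandDual.2 ⟨_, rfl⟩, ?_⟩
    simp only [bracket, form_sumForm]
    simp
  refine mem_of_span_eq_top (S := {r | r • ((0, x₀, 0) : Q × P × Module.Dual R P) ∈ N}) ?_
    fun r hr => hr
  refine ideal_eq_top_of_forall_maximal fun 𝔪 hm => ?_
  obtain ⟨f, g, x, y, hx, hy, hfy, hgx⟩ := exists_biorthogonal_pairs (P := P)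
    ⟨𝔪, hm.isPrime⟩ hm (hP _)
  refine ⟨f x * g y, Ideal.subset_span ?_, hm.isPrime.mul_notMem hx hy⟩
  have h1 := hN f x y
  have h2 := hN g y x₀
  change _ ∈ N
  convert add_mem (N.smul_mem (f x) h2) (N.smul_mem (g x₀) h1) using 1
  simp only [hfy, Prod.smul_mk, Prod.mk_add_mk, smul_zero, add_zero]
  congr 2
  module

lemma summandDual_le_span : summandDual R Q P ≤ Submodule.span R {p | ∃ f ∈ summandDual R Q P,
    ∃ f' ∈ summandDual R Q P, ∃ x ∈ summandP R Q P, p = bracket (sumForm q P) x f f'} := by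
  intro v hv
  obtain ⟨f₀, rfl⟩ := mem_summandDual.1 hv
  set N := Submodule.span R {p | ∃ f ∈ summandDual R Q P,
    ∃ f' ∈ summandDual R Q P, ∃ x ∈ summandP R Q P, p = bracket (sumForm q P) x f f'}
  have hN : ∀ (x : P) (f f' : Module.Dual R P),
      ((0, 0, f x • f' - f' x • f) : Q × P × Module.Dual R P) ∈ N := by
    intro x f f'
    refine Submodule.subset_span ⟨(0, 0, f), mem_summandDual.2 ⟨_, rfl⟩, (0, 0, f'),
      mem_summandDual.2 ⟨_, rfl⟩, (0, x, 0), mem_summandP.2 ⟨_, rfl⟩, ?_⟩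
    simp only [bracket, form_sumForm]
    simp
  refine mem_of_span_eq_top (S := {r | r • ((0, 0, f₀) : Q × P × Module.Dual R P) ∈ N}) ?_
    fun r hr => hr
  refine ideal_eq_top_of_forall_maximal fun 𝔪 hm => ?_
  obtain ⟨f, g, x, y, hx, hy, hfy, hgx⟩ := exists_biorthogonal_pairs (P := P)
    ⟨𝔪, hm.isPrime⟩ hm (hP _)
  refine ⟨f x * g y, Ideal.subset_span ?_, hm.isPrime.mul_notMem hx hy⟩
  have h1 := hN x f g
  have h2 := hN y g f₀
  change _ ∈ N
  convert add_mem (N.smul_mem (f x) h2) (N.smul_mem (f₀ y) h1) using 1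
  simp only [hgx, Prod.smul_mk, Prod.mk_add_mk, smul_zero, add_zero]
  congr 2
  module

end Finite

variable [Invertible (2 : R)] {I : Ideal R}

lemma dserPlus_mono {I J : Ideal R} (h : I ≤ J) : dserPlus q P I ⊆ dserPlus q P J := by
  rintro g ⟨α, α', h1, h2, h3⟩
  exact ⟨α, α', h1, fun z => Submodule.smul_mono_left h (h2 z), h3⟩

lemma dserMinus_mono {I J : Ideal R} (h : I ≤ J) : dserMinus q P I ⊆ dserMinus q P J := by
  rintro g ⟨α, α', h1, h2, h3⟩
  exact ⟨α, α', h1, fun z => Submodule.smul_mono_left h (h2 z), h3⟩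

lemma EOTrue_mono {I J : Ideal R} (h : I ≤ J) : EOTrue q P I ≤ EOTrue q P J :=
  Subgroup.closure_mono (Set.union_subset_union (dserPlus_mono h) (dserMinus_mono h))

lemma EOTrue_le_EORel : EOTrue q P I ≤ EORel q P I := fun g hg =>
  mem_map_normalClosure (g := ⟨g, EOTrue_mono le_top hg⟩) hg

lemma esdEquiv_mem_dserPlus {J : Ideal R} (x : P) (w : Q) {a : R} (ha : a ∈ J) {g : _ ≃ₗ[R] _}
    (hg : ∀ y, g y = esd (sumForm q P) (0, x, 0) (a • (w, 0, 0)) y) : g ∈ dserPlus q P J := by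
  refine ⟨(form q w).smulRight (a • x), (Module.Dual.eval R P x).smulRight (a • w), ?_, ?_, ?_⟩
  · ext f z
    simp only [LinearMap.comp_apply, LinearMap.smulRight_apply, map_smul, LinearMap.smul_apply,
      LinearMap.dualMap_apply, smul_eq_mul, Module.Dual.eval_apply]
    ring
  · intro z
    exact Submodule.smul_mem _ _ (Submodule.smul_mem_smul ha Submodule.mem_top)
  · intro z x' f
    have h2 : (⅟2 : R) * 2 = 1 := invOf_mul_self _
    rw [hg]
    simp only [esd, form_sumForm, q_smul, sumForm_apply, map_smul, LinearMap.smul_apply,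
      LinearMap.smulRight_apply, form_self]
    refine Prod.ext ?_ (Prod.ext ?_ ?_)
    · simp
    · simp
      match_scalars
      · ring
      · linear_combination (a * a * q w * f x) * h2
    · simp

lemma esdEquiv_mem_dserMinus {J : Ideal R} (f : Module.Dual R P) (w : Q) {a : R} (ha : a ∈ J)
    {g : _ ≃ₗ[R] _}
    (hg : ∀ y, g y = esd (sumForm q P) (0, 0, f) (a • (w, 0, 0)) y) : g ∈ dserMinus q P J := by
  refine ⟨(form q w).smulRight (a • f), f.smulRight (a • w), ?_, ?_, ?_⟩
  · ext x z
    simp only [LinearMap.comp_apply, LinearMap.smulRight_apply, map_smul, LinearMap.smul_apply,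
      LinearMap.dualMap_apply, smul_eq_mul, Module.Dual.eval_apply]
    ring
  · intro z
    exact Submodule.smul_mem _ _ (Submodule.smul_mem_smul ha Submodule.mem_top)
  · intro z x f'
    have h2 : (⅟2 : R) * 2 = 1 := invOf_mul_self _
    rw [hg]
    simp only [esd, form_sumForm, q_smul, sumForm_apply, map_smul, LinearMap.smul_apply,
      LinearMap.smulRight_apply, form_self]
    refine Prod.ext ?_ (Prod.ext ?_ ?_)
    · simp
    · simp
    · simp
      match_scalars
      · ring
      · linear_combination (a * a * q w * f x) * h2

end OrthogonalSum

/-! ### Comparison of the two groups -/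

section Comparison

/-- `σ_{u,v}` lies in `N` if `v ∈ IM` is orthogonal to the isotropic vector `u` and `⟨u,y⟩ = 1`
for some `y`: writing `v = ∑ aᵢ vᵢ` with `aᵢ ∈ I`, one has `v = [y, v]_u = ∑ aᵢ [y, vᵢ]_u`. -/
lemma EichlerFrame.mem_of_eq_esd {R : Type*} [CommRing R] [Invertible (2 : R)]
    {M : Type*} [AddCommGroup M] [Module R M]
    {q : QuadraticForm R M} {I : Ideal R} {H N : Subgroup (M ≃ₗ[R] M)} {A B C : Submodule R M}
    (F : EichlerFrame q I H N A B C) {u y v : M} (hu : q u = 0) (huy : form q u y = 1)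
    (huv : form q u v = 0) (hv : v ∈ I • (⊤ : Submodule R M)) {g : M ≃ₗ[R] M}
    (hg : ∀ x, g x = esd q u v x) : g ∈ N := by
  have key : ∃ h ∈ N, ∀ x, h x = esd q u (bracket q u y v) x := by
    refine Submodule.smul_induction_on hv (fun a ha w _ => ?_) ?_
    · obtain ⟨h, hh, -, hhN⟩ := ((mem_transvectionModule hu).1 (F.bracket_mem hu y w)).2 a
      refine ⟨h, hhN ha, fun x => ?_⟩
      rw [hh, ← bracketₗ_apply, ← bracketₗ_apply, map_smul]
    · rintro w w' ⟨h, hN, hh⟩ ⟨h', hN', hh'⟩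
      refine ⟨h * h', N.mul_mem hN hN', fun x => ?_⟩
      rw [LinearEquiv.mul_apply, hh', hh, esd_comp hu (form_bracket ..) (form_bracket ..),
        ← bracketₗ_apply, ← bracketₗ_apply, ← bracketₗ_apply, map_add]
  obtain ⟨h, hN, hh⟩ := key
  convert hN
  ext x
  rw [hg, hh, bracket, huy, huv]
  simp

variable {R : Type*} [CommRing R] [Invertible (2 : R)] {I : Ideal R} {Q P : Type*}
  [AddCommGroup Q] [Module R Q] [AddCommGroup P] [Module R P] {q : QuadraticForm R Q}

omit [Invertible (2 : R)] in
lemma form_surjective_of_sumForm (hd : Function.Surjective (form (sumForm q P))) :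
    Function.Surjective (form q) := by
  intro φ
  obtain ⟨y, hy⟩ := hd (φ ∘ₗ LinearMap.fst R Q (P × Module.Dual R P))
  refine ⟨y.1, LinearMap.ext fun z => ?_⟩
  have := LinearMap.congr_fun hy (z, 0, 0)
  rw [form_sumForm] at this
  simpa using this

section Frame

variable [Module.Finite R P] [Module.Projective R P]

/-- The summands `P`, `P*` and `Q` form a frame for the groups `EO`. -/
lemma eichlerFrame_summands (hP : ∀ p : PrimeSpectrum R, 2 ≤ Module.rankAtStalk P p)
    (hQ : Ideal.span {r | ∃ z z' : Q, r = form q z z'} = ⊤) :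
    EichlerFrame (sumForm q P) I (EO q P) (EORel q P I)
      (summandP R Q P) (summandDual R Q P) (summandQ R Q P) where
  conj_mem _ hh _ hn := conj_mem_map_normalClosure hh hn
  isotropic_left := isotropic_of_mem_summandP
  isotropic_right := isotropic_of_mem_summandDual
  form_left := form_summandP_summandQ
  form_right := form_summandDual_summandQ
  le_left := by
    intro v hv w hw
    have hv0 := isotropic_of_mem_summandP (q := q) v hv
    have hvw := form_summandP_summandQ (q := q) v hv w hw
    refine (mem_transvectionModule hv0).2 ⟨hvw, fun a => ?_⟩
    obtain ⟨x, rfl⟩ := mem_summandP.1 hv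
    obtain ⟨z, rfl⟩ := mem_summandQ.1 hw
    refine ⟨esdEquiv (sumForm q P) hv0 (v := a • (z, 0, 0)) (by rw [map_smul, hvw, smul_zero]),
      fun _ => rfl, ?_, fun ha => EOTrue_le_EORel ?_⟩
    · exact Subgroup.subset_closure (Or.inl (esdEquiv_mem_dserPlus x z (a := a)
        Submodule.mem_top fun _ => rfl))
    · exact Subgroup.subset_closure (Or.inl (esdEquiv_mem_dserPlus x z ha fun _ => rfl))
  le_right := by
    intro v hv w hw
    have hv0 := isotropic_of_mem_summandDual (q := q) v hv
    have hvw := form_summandDual_summandQ (q := q) v hv w hw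
    refine (mem_transvectionModule hv0).2 ⟨hvw, fun a => ?_⟩
    obtain ⟨x, rfl⟩ := mem_summandDual.1 hv
    obtain ⟨z, rfl⟩ := mem_summandQ.1 hw
    refine ⟨esdEquiv (sumForm q P) hv0 (v := a • (z, 0, 0)) (by rw [map_smul, hvw, smul_zero]),
      fun _ => rfl, ?_, fun ha => EOTrue_le_EORel ?_⟩
    · exact Subgroup.subset_closure (Or.inr (esdEquiv_mem_dserMinus x z (a := a)
        Submodule.mem_top fun _ => rfl))
    · exact Subgroup.subset_closure (Or.inr (esdEquiv_mem_dserMinus x z ha fun _ => rfl))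
  sup_eq_top := by
    refine eq_top_iff.2 fun v _ => ?_
    have : v = (0, v.2.1, 0) + (0, 0, v.2.2) + (v.1, 0, 0) :=
      Prod.ext (by simp) (Prod.ext (by simp) (by simp))
    rw [this]
    exact add_mem (Submodule.mem_sup_left (add_mem
      (Submodule.mem_sup_left (mem_summandP.2 ⟨_, rfl⟩))
      (Submodule.mem_sup_right (mem_summandDual.2 ⟨_, rfl⟩))))
      (Submodule.mem_sup_right (mem_summandQ.2 ⟨_, rfl⟩))
  span_form := by
    refine top_le_iff.1 (hQ ▸ Ideal.span_mono ?_)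
    rintro _ ⟨z, z', rfl⟩
    refine ⟨(z, 0, 0), mem_summandQ.2 ⟨_, rfl⟩, (z', 0, 0), mem_summandQ.2 ⟨_, rfl⟩, ?_⟩
    rw [form_sumForm]
    simp
  span_pairing := by
    refine top_le_iff.1 (span_pairing_eq_top hP ▸ Ideal.span_mono ?_)
    rintro _ ⟨f, x, rfl⟩
    refine ⟨(0, x, 0), mem_summandP.2 ⟨_, rfl⟩, (0, 0, f), mem_summandDual.2 ⟨_, rfl⟩, ?_⟩
    rw [form_sumForm]
    simp
  span_left := summandP_le_span hP
  span_right := summandDual_le_span hP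

lemma esdTransvections_subset_EORel (hP : ∀ p : PrimeSpectrum R, 2 ≤ Module.rankAtStalk P p)
    (hQ : Ideal.span {r | ∃ z z' : Q, r = form q z z'} = ⊤)
    (hd : Function.Surjective (form (sumForm q P))) :
    esdTransvections (sumForm q P) (I • ⊤) ⊆ EORel q P I := by
  rintro g ⟨u, v, ⟨φ, hφ⟩, hu, huv, hv, hg⟩
  obtain ⟨y, rfl⟩ := hd φ
  exact (eichlerFrame_summands hP hQ).mem_of_eq_esd hu ((form_comm _ u y).trans hφ) huv hv hg

end Frame

omit [Invertible (2 : R)] in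
/-- The transvections `σ_{u,v}` with `u` unimodular belong to the groups `TransO`. -/
lemma mem_transvectionModule_TransO {M : Type*} [AddCommGroup M] [Module R M]
    {q : QuadraticForm R M} {u v : M} (hu : IsUnimodular R u) (hu0 : q u = 0)
    (huv : form q u v = 0) : v ∈ transvectionModule q I (TransO q) (TransORel q I) u := by
  refine (mem_transvectionModule hu0).2 ⟨huv, fun a => ?_⟩
  have hav : form q u (a • v) = 0 := by rw [map_smul, huv, smul_zero]
  have hmem : esdEquiv q hu0 hav ∈ TransO q :=
    Subgroup.subset_closure ⟨u, a • v, hu, hu0, hav, Submodule.mem_top, fun _ => rfl⟩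
  exact ⟨esdEquiv q hu0 hav, fun _ => rfl, hmem, fun ha =>
    mem_map_normalClosure (g := ⟨_, hmem⟩) ⟨u, a • v, hu, hu0, hav,
      Submodule.smul_mem_smul ha Submodule.mem_top, fun _ => rfl⟩⟩

omit [Invertible (2 : R)] in
/-- Two orthogonal hyperbolic pairs of `H(P)` yield a frame for the groups `TransO`. -/
lemma exists_eichlerFrame_TransO (hhyp : HyperbolicRankGE (hyperbolic R P) 2)
    (hQ : Ideal.span {r | ∃ z z' : Q, r = form q z z'} = ⊤) :
    ∃ A B C, EichlerFrame (sumForm q P) I (TransO (sumForm q P)) (TransORel (sumForm q P) I)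
      A B C := by
  obtain ⟨e, f, he, hf, hef, hee, hff⟩ := hhyp
  have hq : ∀ h : P × Module.Dual R P, sumForm q P (0, h) = hyperbolic R P h := fun h => by
    simp [sumForm]
  have hform : ∀ h k : P × Module.Dual R P,
      form (sumForm q P) (0, h) (0, k) = form (hyperbolic R P) h k := fun h k => by
    simp [form, QuadraticMap.polar, hq]
  have hform' : ∀ (h : P × Module.Dual R P) (z : Q),
      form (sumForm q P) (0, h) (z, 0) = 0 := fun h z => by
    rw [form_sumForm]; simp
  refine ⟨_, _, _, eichlerFrame_of_pairs (e := fun i => (0, e i)) (f := fun i => (0, f i))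
    (fun h hh n hn => conj_mem_map_normalClosure hh hn)
    (fun u v hu hu0 huv => mem_transvectionModule_TransO hu hu0 huv)
    (fun i => (hq _).trans (he i)) (fun i => (hq _).trans (hf i))
    (fun i j => (hform _ _).trans (hef i j)) (fun i j h => (hform _ _).trans (hee i j h))
    (fun i j h => (hform _ _).trans (hff i j h)) (top_le_iff.1 (hQ ▸ Ideal.span_mono ?_))⟩
  rintro _ ⟨z, z', rfl⟩
  refine ⟨(z, 0), ?_, (z', 0), ?_, ?_⟩
  · exact mem_pairsComplement.2 ⟨fun i => hform' _ _, fun i => hform' _ _⟩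
  · exact mem_pairsComplement.2 ⟨fun i => hform' _ _, fun i => hform' _ _⟩
  · rw [form_sumForm]
    simp

section Elementary

variable [Module.Finite R Q] [Module.Projective R Q] [Module.Finite R P] [Module.Projective R P]
  (hP : ∀ p : PrimeSpectrum R, 2 ≤ Module.rankAtStalk P p)
  (hhyp : HyperbolicRankGE (hyperbolic R P) 2)
  (hQ : Ideal.span {r | ∃ z z' : Q, r = form q z z'} = ⊤)
  (hd : Function.Surjective (form q)) (hinj : Function.Injective (form q))

include hP hhyp hQ hd hinj

lemma dserPlus_subset_TransORel : dserPlus q P I ⊆ TransORel (sumForm q P) I := by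
  rintro g ⟨α, α', hstar, hα, hg⟩
  obtain ⟨A₀, B₀, C₀, F⟩ := exists_eichlerFrame_TransO (I := I) hhyp hQ
  have hspan : Ideal.span {r | ∃ x ∈ summandP R Q P, ∃ y, r = form (sumForm q P) x y} = ⊤ := by
    refine top_le_iff.1 (span_pairing_eq_top hP ▸ Ideal.span_mono ?_)
    rintro _ ⟨f, x, rfl⟩
    refine ⟨(0, x, 0), mem_summandP.2 ⟨_, rfl⟩, (0, 0, f), ?_⟩
    rw [form_sumForm]
    simp
  have hiso := isotropic_of_mem_summandP (q := q) (P := P)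
  have hPP : ∀ x ∈ summandP R Q P, ∀ x' ∈ summandP R Q P, form (sumForm q P) x x' = 0 := by
    intro v hv w hw
    obtain ⟨x, rfl⟩ := mem_summandP.1 hv
    obtain ⟨y, rfl⟩ := mem_summandP.1 hw
    rw [form_sumForm]
    simp
  -- `g` is the exponential of `(z, x, f) ↦ (-α' f, α z, 0)`.
  obtain ⟨k, φ, z, hz⟩ := exists_dual_basis R Q
  choose w hw using fun i => hd (φ i)
  let j : P →ₗ[R] Q × (P × Module.Dual R P) := LinearMap.inr R Q _ ∘ₗ LinearMap.inl R P _
  let S := ∑ i, skew (sumForm q P) (w i, 0, 0) (j (α (z i)))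
  have hS : S ∈ skewMonoid (sumForm q P) I (summandP R Q P) (summandQ R Q P) :=
    sum_mem fun i _ => skew_mem_skewMonoid j (fun y => mem_summandP.2 ⟨y, rfl⟩)
      (mem_summandQ.2 ⟨_, rfl⟩) (hα (z i))
  have hα' : ∀ f, ∑ i, f (α (z i)) • w i = α' f := by
    intro f
    refine hinj (LinearMap.ext fun y => ?_)
    have h1 : form q (α' f) y = f (α y) := LinearMap.congr_fun (LinearMap.congr_fun hstar f) y
    rw [h1]
    conv_rhs => rw [hz y]
    simp only [map_sum, map_smul, LinearMap.sum_apply, LinearMap.smul_apply, hw, smul_eq_mul,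
      mul_comm]
  have hαz : ∀ y, ∑ i, φ i y • α (z i) = α y := fun y => by
    conv_rhs => rw [hz y]
    simp only [map_sum, map_smul]
  have hSv : ∀ y x f, S (y, (x, f)) = (-α' f, (α y, 0)) := by
    intro y x f
    rw [← hα' f, ← hαz y]
    simp only [S, LinearMap.sum_apply, skew_apply, form_sumForm, j]
    refine Prod.ext ?_ (Prod.ext ?_ ?_)
    · simp [Prod.fst_sum]
    · simp [Prod.fst_sum, Prod.snd_sum, hw]
    · simp [Prod.snd_sum]
  obtain ⟨h, hN, hh⟩ := exists_exp_of_mem_skewMonoid (I := I)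
    (H := TransO (sumForm q P)) (N := TransORel (sumForm q P) I) hiso form_summandP_summandQ
    (fun x hx y hy => F.mem_of_totally_isotropic hiso hspan hx fun x' hx' => hPP x' hx' y hy)
    (fun x hx y hy => F.mem_of_totally_isotropic hiso hspan hx
      fun x' hx' => form_summandP_summandQ x' hx' y hy) hS
  have hgh : g = h := by
    refine LinearEquiv.ext ?_
    rintro ⟨y, x, f⟩
    rw [hg, hh, hSv, hSv]
    simp [sub_eq_add_neg]
  exact hgh ▸ hN

lemma dserMinus_subset_TransORel : dserMinus q P I ⊆ TransORel (sumForm q P) I := by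
  rintro g ⟨β, β', hstar, hβ, hg⟩
  obtain ⟨A₀, B₀, C₀, F⟩ := exists_eichlerFrame_TransO (I := I) hhyp hQ
  have hspan : Ideal.span {r | ∃ x ∈ summandDual R Q P, ∃ y, r = form (sumForm q P) x y} = ⊤ := by
    refine top_le_iff.1 (span_pairing_eq_top hP ▸ Ideal.span_mono ?_)
    rintro _ ⟨f, x, rfl⟩
    refine ⟨(0, 0, f), mem_summandDual.2 ⟨_, rfl⟩, (0, x, 0), ?_⟩
    rw [form_sumForm]
    simp
  have hiso := isotropic_of_mem_summandDual (q := q) (P := P)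
  have hPP : ∀ x ∈ summandDual R Q P, ∀ x' ∈ summandDual R Q P,
      form (sumForm q P) x x' = 0 := by
    intro v hv w hw
    obtain ⟨x, rfl⟩ := mem_summandDual.1 hv
    obtain ⟨y, rfl⟩ := mem_summandDual.1 hw
    rw [form_sumForm]
    simp
  -- `g` is the exponential of `(z, x, f) ↦ (-β' x, 0, β z)`.
  obtain ⟨k, φ, z, hz⟩ := exists_dual_basis R Q
  choose w hw using fun i => hd (φ i)
  let j : Module.Dual R P →ₗ[R] Q × (P × Module.Dual R P) :=
    LinearMap.inr R Q _ ∘ₗ LinearMap.inr R P _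
  let S := ∑ i, skew (sumForm q P) (w i, 0, 0) (j (β (z i)))
  have hS : S ∈ skewMonoid (sumForm q P) I (summandDual R Q P) (summandQ R Q P) :=
    sum_mem fun i _ => skew_mem_skewMonoid j (fun y => mem_summandDual.2 ⟨y, rfl⟩)
      (mem_summandQ.2 ⟨_, rfl⟩) (hβ (z i))
  have hβ' : ∀ x, ∑ i, β (z i) x • w i = β' x := by
    intro x
    refine hinj (LinearMap.ext fun y => ?_)
    have h1 : form q (β' x) y = β y x := LinearMap.congr_fun (LinearMap.congr_fun hstar x) y
    rw [h1]
    conv_rhs => rw [hz y]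
    simp only [map_sum, map_smul, LinearMap.sum_apply, LinearMap.smul_apply, hw, smul_eq_mul,
      mul_comm]
  have hβz : ∀ y, ∑ i, φ i y • β (z i) = β y := fun y => by
    conv_rhs => rw [hz y]
    simp only [map_sum, map_smul]
  have hSv : ∀ y x f, S (y, (x, f)) = (-β' x, (0, β y)) := by
    intro y x f
    rw [← hβ' x, ← hβz y]
    simp only [S, LinearMap.sum_apply, skew_apply, form_sumForm, j]
    refine Prod.ext ?_ (Prod.ext ?_ ?_)
    · simp [Prod.fst_sum]
    · simp [Prod.fst_sum, Prod.snd_sum]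
    · simp [Prod.snd_sum, hw]
  obtain ⟨h, hN, hh⟩ := exists_exp_of_mem_skewMonoid (I := I)
    (H := TransO (sumForm q P)) (N := TransORel (sumForm q P) I) hiso form_summandDual_summandQ
    (fun x hx y hy => F.mem_of_totally_isotropic hiso hspan hx fun x' hx' => hPP x' hx' y hy)
    (fun x hx y hy => F.mem_of_totally_isotropic hiso hspan hx
      fun x' hx' => form_summandDual_summandQ x' hx' y hy) hS
  have hgh : g = h := by
    refine LinearEquiv.ext ?_
    rintro ⟨y, x, f⟩
    rw [hg, hh, hSv, hSv]
    simp [sub_eq_add_neg]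
  exact hgh ▸ hN

lemma EOTrue_le_TransORel : EOTrue q P I ≤ TransORel (sumForm q P) I :=
  (Subgroup.closure_le _).2 (Set.union_subset (dserPlus_subset_TransORel hP hhyp hQ hd hinj)
    (dserMinus_subset_TransORel hP hhyp hQ hd hinj))

end Elementary

end Comparison

end DSER

theorem mainTheorem1 {R : Type*} [CommRing R] [Invertible (2 : R)] (I : Ideal R)
    {Q : Type*} [AddCommGroup Q] [Module R Q] [Module.Finite R Q] [Module.Projective R Q]
    (q : QuadraticForm R Q) (hq : (DSER.form q).Nondegenerate)
    {P : Type*} [AddCommGroup P] [Module R P] [Module.Finite R P] [Module.Projective R P]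
    (n m : ℕ) (hn : 1 ≤ n) (hm : 2 ≤ m)
    (hP : ∀ p : PrimeSpectrum R, Module.rankAtStalk P p = m)
    (hhyp : DSER.HyperbolicRankGE (DSER.hyperbolic R P) 2)
    (hstd : ∀ (𝔪 : Ideal R) [𝔪.IsMaximal], DSER.IsStandardAt (DSER.sumForm q P) 𝔪 (n + 2 * m)) :
    DSER.TransORel (DSER.sumForm q P) I = DSER.EORel q P I := by
  have hd := DSER.form_surjective_of_isStandardAt hstd
  have hdQ := DSER.form_surjective_of_sumForm hd
  have hQ := DSER.span_form_eq_top hn hP hstd hdQ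
  have hP2 : ∀ p : PrimeSpectrum R, 2 ≤ Module.rankAtStalk P p := fun p => (hP p).symm ▸ hm
  have hinj : Function.Injective (DSER.form q) := LinearMap.ker_eq_bot.1 hq.ker_eq_bot
  have h1 : ∀ J : Ideal R, DSER.esdTransvections (DSER.sumForm q P) (J • ⊤) ⊆ DSER.EORel q P J :=
    fun J => DSER.esdTransvections_subset_EORel hP2 hQ hd
  have h2 : ∀ J : Ideal R, DSER.EOTrue q P J ≤ DSER.TransORel (DSER.sumForm q P) J :=
    fun J => DSER.EOTrue_le_TransORel hP2 hhyp hQ hdQ hinj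
  -- The case of the unit ideal shows that the two absolute groups coincide.
  have hEO : DSER.TransO (DSER.sumForm q P) = DSER.EO q P := by
    refine le_antisymm ((Subgroup.closure_le _).2 fun g hg => ?_)
      ((h2 ⊤).trans DSER.map_normalClosure_le_left)
    refine DSER.map_normalClosure_le_left (h1 ⊤ ?_)
    rwa [Submodule.top_smul]
  refine le_antisymm (DSER.map_normalClosure_le (fun s hs => h1 I hs) fun g hg k hk => ?_)
    (DSER.map_normalClosure_le (fun s hs => h2 I hs) fun g hg k hk => ?_)
  · exact DSER.conj_mem_map_normalClosure (hEO ▸ hg) hk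
  · exact DSER.conj_mem_map_normalClosure (hEO.symm ▸ hg) hk
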